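/- Let $d\ge 1$, $q\in(0,1)$, $\Omega=\{0,1\}^{\mathbb Z^d}$ (zeros are empty sites), and let $\mu$ be the product Bernoulli measure on $\Omega$ with $\mu(\eta_x=1)=1-q$. Write $\eta^x$ for $\eta$ flipped at $x$, $(\eta_{z+\cdot})_x=\eta_{z+x}$, and $e_1,\dots,e_d$ for the canonical basis of $\mathbb Z^d$. Consider a kinetically constrained model, i.e. constraints $c_x:\Omega\to\{0,1\}$, $x\in\mathbb Z^d$, that are translation invariant, such that $c_x(\eta)$ depends only on $\eta$ in a fixed finite neighbourhood of $x$ (translated with $x$), does not depend on $\eta_x$, and is non-increasing in $\eta$. For local functions $f$ (functions of finitely many coordinates) put $$\mathcal L_Ef(\eta)=\sum_{y\in\mathbb Z^d}c_y(\eta)\big((1-q)(1-\eta_y)+q\eta_y\big)\,[f(\eta^y)-f(\eta)],$$ $$\mathcal Lf(\eta)=\mathcal L_Ef(\eta)+\sum_{i=1}^d\sum_{\alpha=\pm1}(1-\eta_0)(1-\eta_{\alpha e_i})\,[f(\eta_{\alpha e_i+\cdot})-f(\eta)],$$ and denote their closures in $L^2(\mu)$ by the same letters; $\mathcal L$ is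 the generator of the environment seen from a tracer that jumps at rate one between neighbouring empty sites. Let $$\mathrm{gap}(\mathcal L_E)=\inf\frac{-\mu(f\mathcal L_Ef)}{\mathrm{Var}_\mu(f)},$$ the infimum being over all $f\in L^2(\mu)$ in the domain of $\mathcal L_E$ with $\mathrm{Var}_\mu(f)\ne0$. For $u\in\mathbb R^d$ let $$j_u(\eta)=(1-\eta_0)\sum_{i=1}^d\sum_{\alpha=\pm1}(1-\eta_{\alpha e_i})\,\alpha u_i ,$$ and define the diffusion matrix $D$ by $$D_{ik}=q^2\delta_{ik}-\int_0^\infty\mu\big(j_{e_i}e^{t\mathcal L}j_{e_k}\big)\,dt .$$ Then $\mathcal L$ generates a strongly continuous contraction semigroup $(e^{t\mathcal L})_{t\ge0}$ on $L^2(\mu)$; for every $u\in\mathbb R^d$ the function $t\mapsto\mu(j_ue^{t\mathcal L}j_u)$ is integrable on $(0,\infty)$ and $$u\cdot Du=q^2\|u\|_2^2-\int_0^\infty\mu\big(j_ue^{t\mathcal L}j_u\big)\,dt ;$$ and for every $u\in\mathbb R^d$ $$q^2\|u\|_2^2\;\ge\;u\cdot Du\;\ge\;\frac{\mathrm{gap}(\mathcal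 L_E)}{4d+\mathrm{gap}(\mathcal L_E)}\,q^2\|u\|_2^2 .$$ In particular, if $\mathrm{gap}(\mathcal L_E)>0$, then $D$ is (symmetric) positive definite. -/

import Mathlib

open MeasureTheory Filter Topology
open scoped NNReal ENNReal unitInterval

noncomputable section

namespace Tracer

/-! ## Configurations -/

/-- The lattice `ℤ^d`. -/
abbrev Site (d : ℕ) : Type := Fin d → ℤ

/-- `{0,1}^{ℤ^d}`: `true` is an occupied site (a one), `false` is an empty site (a zero). -/
abbrev Config (d : ℕ) : Type := Site d → Bool

variable {d : ℕ}

/-- The occupation number `η_x`, as a real number. -/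
def occ (η : Config d) (x : Site d) : ℝ := if η x then 1 else 0

/-- The configuration `η^x`, in which the occupation variable at `x` is flipped. -/
def flipAt (x : Site d) (η : Config d) : Config d := Function.update η x (!η x)

/-- The translated configuration `η_{z+·}`. -/
def shift (z : Site d) (η : Config d) : Config d := fun x => η (z + x)

/-- The `i`-th vector of the canonical basis of `ℤ^d`. -/
def unitVec (i : Fin d) : Site d := Pi.single i 1

/-- The product Bernoulli measure under which each site is empty with probability `q` and occupied
with probability `1 - q`. -/
def mu (d : ℕ) (q : I) : Measure (Config d) :=
  Measure.infinitePi fun _ => ProbabilityTheory.bernoulliMeasure false true q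

instance (q : I) : IsProbabilityMeasure (mu d q) := by
  unfold mu; infer_instance

/-- The real Hilbert space `L²(μ)`. -/
abbrev L2 (d : ℕ) (q : I) : Type := Lp ℝ 2 (mu d q)

/-- A local function depends on finitely many sites only. -/
def IsLocal (f : Config d → ℝ) : Prop := ∃ A : Finset (Site d), DependsOn f (A : Set (Site d))

/-! ## Kinetically constrained models and their generators -/

/-- The constraints of a kinetically constrained model on `ℤ^d`; `c x η = true` means that the
constraint at `x` is satisfied by `η`. -/
structure KCSM (d : ℕ) where
  /-- the constraints -/
  c : Site d → Config d → Bool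
  /-- translation invariance -/
  c_shift : ∀ (z x : Site d) (η : Config d), c x (shift z η) = c (z + x) η
  /-- `c x` depends on a fixed finite neighbourhood of `x` only -/
  finite_range : ∃ A : Finset (Site d), ∀ (x : Site d) (η η' : Config d),
    (∀ a ∈ A, η (x + a) = η' (x + a)) → c x η = c x η'
  /-- `c x` does not depend on the occupation variable at `x` -/
  c_flip : ∀ (x : Site d) (η : Config d), c x (flipAt x η) = c x η
  /-- the more zeros, the more constraints are satisfied -/
  c_antitone : ∀ η η' : Config d, (∀ x, η x ≤ η' x) → ∀ x, c x η' ≤ c x η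

/-- The rate `c_y(η) ((1-q)(1-η_y) + q η_y)` of the flip at `y`. -/
def KCSM.rate (K : KCSM d) (q : I) (y : Site d) (η : Config d) : ℝ :=
  (if K.c y η then 1 else 0) * ((1 - (q : ℝ)) * (1 - occ η y) + (q : ℝ) * occ η y)

/-- The generator `L_E` of the environment on local functions (for which the sum is finite). -/
def KCSM.envOp (K : KCSM d) (q : I) (f : Config d → ℝ) (η : Config d) : ℝ :=
  ∑' y : Site d, K.rate q y η * (f (flipAt y η) - f η)

/-- The part of the generator that comes from the jumps of the tracer: it jumps with rate one to
each neighbour, provided that both the site where it sits and the target site are empty. -/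
def jumpOp (f : Config d → ℝ) (η : Config d) : ℝ :=
  ∑ i : Fin d, ∑ α ∈ ({1, -1} : Finset ℤ),
    (1 - occ η 0) * (1 - occ η (α • unitVec i)) * (f (shift (α • unitVec i) η) - f η)

/-- The generator `L` of the environment seen from the tracer, on local functions. -/
def KCSM.tracerOp (K : KCSM d) (q : I) (f : Config d → ℝ) (η : Config d) : ℝ :=
  K.envOp q f η + jumpOp f η

/-- The graph in `L²(μ) × L²(μ)` of the closure of an operator given on local functions. -/
def closedGraph (q : I) (T : (Config d → ℝ) → Config d → ℝ) : Set (L2 d q × L2 d q) :=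
  closure {p | ∃ f : Config d → ℝ, IsLocal f ∧ p.1 =ᵐ[mu d q] f ∧ p.2 =ᵐ[mu d q] T f}

/-- The graph of the `L²(μ)` generator of the environment. -/
def KCSM.envGenerator (K : KCSM d) (q : I) : Set (L2 d q × L2 d q) := closedGraph q (K.envOp q)

/-- The graph of the `L²(μ)` generator of the environment seen from the tracer. -/
def KCSM.tracerGenerator (K : KCSM d) (q : I) : Set (L2 d q × L2 d q) :=
  closedGraph q (K.tracerOp q)

/-- The spectral gap of the environment: the infimum of `-μ(f L_E f) / Var_μ(f)` over all `f` in the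
domain of the `L²(μ)` generator that have non-zero variance. -/
def KCSM.gap (K : KCSM d) (q : I) : ℝ :=
  sInf {r | ∃ f g : L2 d q, (f, g) ∈ K.envGenerator q ∧
    ProbabilityTheory.variance f (mu d q) ≠ 0 ∧
    r = -(∫ η, f η * g η ∂(mu d q)) / ProbabilityTheory.variance f (mu d q)}

/-! ## Semigroups -/

/-- A strongly continuous contraction semigroup on a real normed space. -/
structure ContractionSemigroup (H : Type*) [NormedAddCommGroup H] [NormedSpace ℝ H] where
  /-- the operators -/
  op : ℝ≥0 → H →L[ℝ] H
  op_zero : op 0 = ContinuousLinearMap.id ℝ H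
  op_add : ∀ s t, op (s + t) = (op s).comp (op t)
  norm_op_le : ∀ t, ‖op t‖ ≤ 1
  continuous_op : ∀ f, Continuous fun t => op t f

/-- `S` has the generator with graph `G`: a pair `(f, g)` is in `G` if and only if
`(S_t f - f) / t → g` as `t → 0+`. A strongly continuous semigroup is determined by its generator. -/
def ContractionSemigroup.HasGenerator {H : Type*} [NormedAddCommGroup H] [NormedSpace ℝ H]
    (S : ContractionSemigroup H) (G : Set (H × H)) : Prop :=
  ∀ f g : H, (f, g) ∈ G ↔
    Tendsto (fun t : ℝ≥0 => (t : ℝ)⁻¹ • (S.op t f - f)) (𝓝[>] 0) (𝓝 g)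

open Classical in
/-- `e^{tG}`, for the graph `G` of the generator of a contraction semigroup
(zero if `G` generates none). -/
def expOp {H : Type*} [NormedAddCommGroup H] [NormedSpace ℝ H] (G : Set (H × H)) (t : ℝ≥0) :
    H →L[ℝ] H :=
  if h : ∃ S : ContractionSemigroup H, S.HasGenerator G then h.choose.op t else 0

/-! ## The diffusion matrix -/

/-- The current `j_u(η) = (1 - η_0) ∑_i ∑_{α = ±1} (1 - η_{α e_i}) α u_i`. -/
def current (u : Fin d → ℝ) (η : Config d) : ℝ :=
  (1 - occ η 0) * ∑ i : Fin d, ∑ α ∈ ({1, -1} : Finset ℤ),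
    (1 - occ η (α • unitVec i)) * (α : ℝ) * u i

theorem measurable_occ (x : Site d) : Measurable fun η : Config d => occ η x := by
  have h : Measurable fun b : Bool => if b then (1 : ℝ) else 0 := measurable_from_top
  exact h.comp (measurable_pi_apply x)

theorem occ_mem (η : Config d) (x : Site d) : 0 ≤ 1 - occ η x ∧ 1 - occ η x ≤ 1 := by
  unfold occ; split_ifs <;> norm_num

theorem memLp_current (q : I) (u : Fin d → ℝ) : MemLp (current u) 2 (mu d q) := by
  have hm : Measurable (current u) := by
    unfold current
    refine (measurable_const.sub (measurable_occ 0)).mul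
      (Finset.measurable_sum _ fun i _ => Finset.measurable_sum _ fun α _ => ?_)
    exact ((measurable_const.sub (measurable_occ _)).mul measurable_const).mul measurable_const
  refine MemLp.of_bound hm.aestronglyMeasurable
    (∑ i : Fin d, ∑ α ∈ ({1, -1} : Finset ℤ), |(α : ℝ)| * |u i|) (Eventually.of_forall fun η => ?_)
  have h0 := occ_mem η 0
  rw [current, Real.norm_eq_abs, abs_mul, abs_of_nonneg h0.1]
  refine (mul_le_of_le_one_left (abs_nonneg _) h0.2).trans ?_
  refine (Finset.abs_sum_le_sum_abs _ _).trans (Finset.sum_le_sum fun i _ => ?_)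
  refine (Finset.abs_sum_le_sum_abs _ _).trans (Finset.sum_le_sum fun α _ => ?_)
  have h1 := occ_mem η (α • unitVec i)
  rw [abs_mul, abs_mul, abs_of_nonneg h1.1]
  gcongr
  exact mul_le_of_le_one_left (abs_nonneg _) h1.2

/-- The time correlation `μ(j_u e^{tL} j_v)`. -/
def KCSM.corr (K : KCSM d) (q : I) (u v : Fin d → ℝ) (t : ℝ≥0) : ℝ :=
  ∫ η, current u η * expOp (K.tracerGenerator q) t (memLp_current q v).toLp η ∂(mu d q)

/-- The diffusion matrix
`D_{ik} = q² δ_{ik} - ∫_0^∞ μ(j_{e_i} e^{tL} j_{e_k}) dt`. -/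
def KCSM.diffusionMatrix (K : KCSM d) (q : I) : Matrix (Fin d) (Fin d) ℝ :=
  Matrix.of fun i k => (if i = k then (q : ℝ) ^ 2 else 0) -
    ∫ t in Set.Ioi (0 : ℝ), K.corr q (Pi.single i 1) (Pi.single k 1) t.toNNReal

end Tracer

end

/-!
The flip part `L_E` of `L` is symmetric and dissipative on local functions, and for large `l` the
resolvent equation `l f - L_E f = g` is solved in finite volume. The total influence of the sites on
the solution, weighted by their distance to the origin, is bounded uniformly in the volume, so the
finite-volume solutions solve the equation up to small errors. By the Hille–Yosida theorem the
closure of `L_E` is a generator, and so is that of its bounded perturbation `L`.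

The reversibility of the jumps turns `μ(j_u f)` into an expectation of `u_i (f(η_{e_i+·}) - f(η))`
over the open bonds, so Cauchy–Schwarz bounds `μ(j_u f)²` by `q² ‖u‖²` times the Dirichlet form of
the jumps. That form is at most `4d Var(f)`, and `gap(L_E) Var(f)` is at most the Dirichlet form of
the flips; hence `μ(j_u f)² ≤ 4d / (4d + gap(L_E)) q² ‖u‖² μ(f (-L) f)`. Applied to
`f = ∫₀ˢ e^{tL} j_u dt` this bounds `∫₀^∞ μ(j_u e^{tL} j_u) dt`.
-/

noncomputable section

namespace Tracer

/-! ## Exponentials of bounded operators -/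

section Exponential

variable {E : Type*} [NormedAddCommGroup E] [NormedSpace ℝ E]

theorem exp_smul_apply_comm {A B : E →L[ℝ] E} (h : Commute A B) (t : ℝ) (f : E) :
    NormedSpace.exp (t • A) (B f) = B (NormedSpace.exp (t • A) f) :=
  DFunLike.congr_fun (h.smul_left t).exp_left.eq f

theorem norm_exp_le (A : E →L[ℝ] E) : ‖NormedSpace.exp A‖ ≤ Real.exp ‖A‖ := by
  have hterm (n : ℕ) : ‖((n.factorial : ℝ)⁻¹) • A ^ n‖ ≤ ((n.factorial : ℝ)⁻¹) • ‖A‖ ^ n := by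
    rw [norm_smul, norm_inv, RCLike.norm_natCast, smul_eq_mul]
    gcongr
    rcases n.eq_zero_or_pos with rfl | hn
    · rw [pow_zero, pow_zero]
      exact ContinuousLinearMap.norm_id_le
    · exact norm_pow_le' A hn
  have hsum := NormedSpace.expSeries_summable' (𝕂 := ℝ) ‖A‖
  rw [Real.exp_eq_exp_ℝ, NormedSpace.exp_eq_tsum ℝ, NormedSpace.exp_eq_tsum ℝ]
  exact tsum_of_norm_bounded hsum.hasSum hterm

variable [CompleteSpace E]

theorem exp_add_of_commute {A B : E →L[ℝ] E} (h : Commute A B) :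
    NormedSpace.exp (A + B) = NormedSpace.exp A * NormedSpace.exp B := by
  let _ : NormedAlgebra ℚ (E →L[ℝ] E) := NormedAlgebra.restrictScalars ℚ ℝ _
  exact NormedSpace.exp_add_of_commute h

theorem hasDerivAt_exp_smul_apply (B : E →L[ℝ] E) (f : E) (t : ℝ) :
    HasDerivAt (fun s : ℝ => NormedSpace.exp (s • B) f) (NormedSpace.exp (t • B) (B f)) t := by
  simpa using (hasDerivAt_exp_smul_const B t).clm_apply (hasDerivAt_const t f)

theorem norm_exp_smul_sub_exp_smul_le {A B : E →L[ℝ] E} (hAB : Commute A B)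
    (hA : ∀ t : ℝ, 0 ≤ t → ‖NormedSpace.exp (t • A)‖ ≤ 1)
    (hB : ∀ t : ℝ, 0 ≤ t → ‖NormedSpace.exp (t • B)‖ ≤ 1) {t : ℝ} (ht : 0 ≤ t) (f : E) :
    ‖NormedSpace.exp (t • A) f - NormedSpace.exp (t • B) f‖ ≤ ‖A f - B f‖ * t := by
  -- The path `s ↦ e^{sA} e^{(t-s)B} f = e^{s(A-B)} e^{tB} f` joins the two vectors.
  have hsplit (s : ℝ) (g : E) : NormedSpace.exp (s • (A - B)) (NormedSpace.exp (t • B) g) =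
      NormedSpace.exp (s • A) (NormedSpace.exp ((t - s) • B) g) := by
    rw [← mul_apply_eq_comp, ← mul_apply_eq_comp,
      ← exp_add_of_commute, ← exp_add_of_commute]
    · congr 2
      module
    · exact (hAB.smul_left _).smul_right _
    · exact ((hAB.sub_left (Commute.refl B)).smul_left _).smul_right _
  have hderiv (s : ℝ) (hs : s ∈ Set.Ico 0 t) :
      ‖NormedSpace.exp (s • (A - B)) ((A - B) (NormedSpace.exp (t • B) f))‖ ≤ ‖A f - B f‖ := by
    rw [← exp_smul_apply_comm (hAB.symm.sub_right (Commute.refl B)), hsplit]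
    exact (ContinuousLinearMap.le_of_opNorm_le _ (hA s hs.1) _).trans_eq (one_mul _) |>.trans <|
      (ContinuousLinearMap.le_of_opNorm_le _ (hB _ (sub_nonneg.2 hs.2.le)) _).trans_eq (one_mul _)
  have h := norm_image_sub_le_of_norm_deriv_le_segment'
    (fun s _ => (hasDerivAt_exp_smul_apply (A - B) _ s).hasDerivWithinAt) hderiv t ⟨ht, le_rfl⟩
  simpa [hsplit] using h

theorem norm_exp_smul_apply_sub_le {B : E →L[ℝ] E}
    (hB : ∀ t : ℝ, 0 ≤ t → ‖NormedSpace.exp (t • B)‖ ≤ 1) {t : ℝ} (ht : 0 ≤ t) (f : E) :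
    ‖NormedSpace.exp (t • B) f - f‖ ≤ ‖B f‖ * t := by
  have hzero (t : ℝ) (_ : 0 ≤ t) : ‖NormedSpace.exp (t • (0 : E →L[ℝ] E))‖ ≤ 1 := by
    rw [smul_zero, NormedSpace.exp_zero]
    exact ContinuousLinearMap.norm_id_le
  simpa using norm_exp_smul_sub_exp_smul_le (Commute.zero_right B) hB hzero ht f

end Exponential

/-! ## Contraction semigroups and their limits -/

section Dense

variable {E : Type*} [NormedAddCommGroup E] [NormedSpace ℝ E]

theorem tendstoUniformly_apply_of_norm_le_one {ι : Type*} {T : ι → E →L[ℝ] E}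
    (hT : ∀ i, ‖T i‖ ≤ 1) (f : E) :
    TendstoUniformly (fun g i => T i g) (fun i => T i f) (𝓝 f) := by
  refine Metric.tendstoUniformly_iff.2 fun ε hε => ?_
  filter_upwards [Metric.ball_mem_nhds f hε] with g hg i
  rw [dist_eq_norm, ← map_sub]
  exact ((T i).le_of_opNorm_le (hT i) _).trans_lt (by rwa [one_mul, ← dist_eq_norm, dist_comm])

theorem continuous_apply_of_dense {X : Type*} [TopologicalSpace X]
    {T : X → E →L[ℝ] E} (hT : ∀ x, ‖T x‖ ≤ 1) {D : Set E} (hD : Dense D)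
    (hcont : ∀ f ∈ D, Continuous fun x => T x f) (f : E) : Continuous fun x => T x f :=
  (tendstoUniformly_apply_of_norm_le_one hT f).continuous <|
    mem_closure_iff_frequently.1 (hD f) |>.mono hcont

theorem cauchySeq_apply_of_dense {T : ℕ → E →L[ℝ] E} (hT : ∀ n, ‖T n‖ ≤ 1)
    {D : Set E} (hD : Dense D) (hcauchy : ∀ f ∈ D, CauchySeq fun n => T n f) (f : E) :
    CauchySeq fun n => T n f := by
  refine Metric.cauchySeq_iff'.2 fun ε hε => ?_
  obtain ⟨g, hg, hgD⟩ := (mem_closure_iff_frequently.1 (hD f)).and_eventually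
    (Metric.tendstoUniformly_iff.1 (tendstoUniformly_apply_of_norm_le_one hT f) _
      (div_pos hε three_pos)) |>.exists
  obtain ⟨N, hN⟩ := Metric.cauchySeq_iff'.1 (hcauchy g hg) _ (div_pos hε three_pos)
  refine ⟨N, fun n hn => ?_⟩
  have htri := dist_triangle4 (T n f) (T n g) (T N g) (T N f)
  rw [dist_comm (T N g)] at htri
  linarith [hgD n, hgD N, hN n hn]

end Dense

namespace ContractionSemigroup

section Basic

variable {E : Type*} [NormedAddCommGroup E] [NormedSpace ℝ E] (S : ContractionSemigroup E)

theorem norm_op_apply_le (t : ℝ≥0) (f : E) : ‖S.op t f‖ ≤ ‖f‖ :=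
  ((S.op t).le_of_opNorm_le (S.norm_op_le t) f).trans_eq (one_mul _)

theorem op_add_apply (s t : ℝ≥0) (f : E) : S.op (s + t) f = S.op s (S.op t f) :=
  DFunLike.congr_fun (S.op_add s t) f

theorem op_zero_apply (f : E) : S.op 0 f = f :=
  DFunLike.congr_fun S.op_zero f

theorem lipschitzWith_op_apply {C : ℝ≥0} {f : E} (hC : ∀ t, ‖S.op t f - f‖ ≤ C * t) :
    LipschitzWith C fun t => S.op t f := by
  refine LipschitzWith.of_dist_le_mul fun s t => ?_
  wlog hst : t ≤ s generalizing s t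
  · rw [dist_comm, dist_comm s]
    exact this t s (le_of_not_ge hst)
  calc dist (S.op s f) (S.op t f) = ‖S.op t (S.op (s - t) f - f)‖ := by
        rw [dist_eq_norm, map_sub, ← op_add_apply, add_tsub_cancel_of_le hst]
    _ ≤ ‖S.op (s - t) f - f‖ := S.norm_op_apply_le t _
    _ ≤ C * (s - t : ℝ≥0) := hC _
    _ = C * dist s t := by
        rw [NNReal.dist_eq, NNReal.coe_sub hst,
          abs_of_nonneg (sub_nonneg.2 (NNReal.coe_le_coe.2 hst))]

/-- The uniformly continuous semigroup `t ↦ e^{tB}` of a bounded operator `B` whose exponentials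
are contractions. -/
def ofExp [CompleteSpace E] (B : E →L[ℝ] E)
    (hB : ∀ t : ℝ, 0 ≤ t → ‖NormedSpace.exp (t • B)‖ ≤ 1) : ContractionSemigroup E where
  op t := NormedSpace.exp ((t : ℝ) • B)
  op_zero := by simp; rfl
  op_add s t := by
    rw [NNReal.coe_add, add_smul,
      exp_add_of_commute (((Commute.refl B).smul_left _).smul_right _)]
    rfl
  norm_op_le t := hB t t.2
  continuous_op f := (continuous_iff_continuousAt.2 fun t =>
    (hasDerivAt_exp_smul_apply B f t).continuousAt).comp NNReal.continuous_coe

end Basic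

section Limit

variable {E : Type*} [NormedAddCommGroup E] [NormedSpace ℝ E] [CompleteSpace E]

theorem exists_tendsto_op (U : ℕ → ContractionSemigroup E) {D : Set E} (hD : Dense D)
    (hcauchy : ∀ f ∈ D, ∀ t, CauchySeq fun n => (U n).op t f)
    (hlip : ∀ f ∈ D, ∃ C : ℝ≥0, ∀ n, LipschitzWith C fun t => (U n).op t f) :
    ∃ S : ContractionSemigroup E, ∀ t f, Tendsto (fun n => (U n).op t f) atTop (𝓝 (S.op t f)) := by
  choose V hV using fun t f => cauchySeq_tendsto_of_complete
    (cauchySeq_apply_of_dense (fun n => (U n).norm_op_le t) hD (hcauchy · · t) f)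
  let T (t : ℝ≥0) : E →L[ℝ] E := continuousLinearMapOfTendsto (fun n => (U n).op t)
    (tendsto_pi_nhds.2 (hV t))
  have hT (t : ℝ≥0) : ‖T t‖ ≤ 1 := (T t).opNorm_le_bound zero_le_one fun f => by
    rw [one_mul]
    exact le_of_tendsto (hV t f).norm (.of_forall fun n => (U n).norm_op_apply_le t f)
  refine ⟨⟨T, ?_, fun s t => ?_, hT, continuous_apply_of_dense hT hD fun f hf => ?_⟩, hV⟩
  · ext f
    exact tendsto_nhds_unique (hV 0 f) (by simp [op_zero_apply])
  · ext f
    refine tendsto_nhds_unique (hV (s + t) f) ?_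
    have herr : Tendsto (fun n => (U n).op s ((U n).op t f - T t f)) atTop (𝓝 0) :=
      squeeze_zero_norm (fun n => (U n).norm_op_apply_le s _)
        (tendsto_iff_norm_sub_tendsto_zero.1 (hV t f))
    have hmain : Tendsto (fun n => (U n).op s (T t f)) atTop (𝓝 (T s (T t f))) := hV s (T t f)
    simpa [op_add_apply] using herr.add hmain
  · obtain ⟨C, hC⟩ := hlip f hf
    refine LipschitzWith.continuous (K := C) <| LipschitzWith.of_dist_le_mul fun s t => ?_
    exact le_of_tendsto ((hV s f).dist (hV t f)) (.of_forall fun n => (hC n).dist_le_mul s t)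

end Limit

end ContractionSemigroup

/-! ## The Hille–Yosida theorem -/

section CommutingApproximation

theorem tendsto_coe_nhdsGT_zero : Tendsto ((↑) : ℝ≥0 → ℝ) (𝓝[>] 0) (𝓝[>] 0) :=
  tendsto_nhdsWithin_iff.2 ⟨(NNReal.continuous_coe.tendsto' 0 0 rfl).mono_left nhdsWithin_le_nhds,
    eventually_nhdsWithin_of_forall fun _ ht => NNReal.coe_pos.2 ht⟩

variable {E : Type*} [NormedAddCommGroup E] [NormedSpace ℝ E] [CompleteSpace E]

theorem tendsto_inv_smul_exp_smul_sub (B : E →L[ℝ] E) (f : E) :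
    Tendsto (fun t : ℝ≥0 => (t : ℝ)⁻¹ • (NormedSpace.exp ((t : ℝ) • B) f - f)) (𝓝[>] 0)
      (𝓝 (B f)) := by
  simpa [Function.comp_def] using
    (hasDerivAt_exp_smul_apply B f 0).tendsto_slope_zero_right.comp tendsto_coe_nhdsGT_zero

theorem ContractionSemigroup.tendsto_inv_smul_of_approx {S : ContractionSemigroup E}
    {B : ℕ → E →L[ℝ] E} {f g : E} (hB : Tendsto (fun n => B n f) atTop (𝓝 g))
    (happrox : ∀ n t, ‖S.op t f - NormedSpace.exp ((t : ℝ) • B n) f‖ ≤ ‖g - B n f‖ * t) :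
    Tendsto (fun t : ℝ≥0 => (t : ℝ)⁻¹ • (S.op t f - f)) (𝓝[>] 0) (𝓝 g) := by
  have hunif : TendstoUniformlyOn
      (fun n (t : ℝ≥0) => (t : ℝ)⁻¹ • (NormedSpace.exp ((t : ℝ) • B n) f - f))
      (fun t => (t : ℝ)⁻¹ • (S.op t f - f)) atTop (Set.Ioi 0) := by
    refine Metric.tendstoUniformlyOn_iff.2 fun ε hε => ?_
    filter_upwards [(tendsto_iff_norm_sub_tendsto_zero.1 hB).eventually_lt_const hε] with n hn t ht
    have ht' : (0 : ℝ) < t := ht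
    calc dist ((t : ℝ)⁻¹ • (S.op t f - f))
          ((t : ℝ)⁻¹ • (NormedSpace.exp ((t : ℝ) • B n) f - f))
        = ‖S.op t f - NormedSpace.exp ((t : ℝ) • B n) f‖ / t := by
          rw [dist_smul₀, dist_sub_right, dist_eq_norm, norm_inv, Real.norm_of_nonneg ht'.le,
            inv_mul_eq_div]
      _ ≤ ‖g - B n f‖ := (div_le_iff₀ ht').2 (happrox n t)
      _ < ε := by rwa [norm_sub_rev]
  exact (hunif.tendstoUniformlyOnFilter.mono_right inf_le_right).tendsto_of_eventually_tendsto
    (.of_forall fun n => tendsto_inv_smul_exp_smul_sub (B n) f) hB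

theorem exists_contractionSemigroup_of_commute {B : ℕ → E →L[ℝ] E}
    (hcomm : ∀ m n, Commute (B m) (B n))
    (hexp : ∀ n (t : ℝ), 0 ≤ t → ‖NormedSpace.exp (t • B n)‖ ≤ 1)
    {G : Set (E × E)} (hdense : Dense (Prod.fst '' G))
    (hB : ∀ p ∈ G, Tendsto (fun n => B n p.1) atTop (𝓝 p.2)) :
    ∃ S : ContractionSemigroup E, ∀ p ∈ G,
      Tendsto (fun t : ℝ≥0 => (t : ℝ)⁻¹ • (S.op t p.1 - p.1)) (𝓝[>] 0) (𝓝 p.2) := by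
  have hdist (m n : ℕ) (t : ℝ≥0) (f : E) :
      ‖NormedSpace.exp ((t : ℝ) • B m) f - NormedSpace.exp ((t : ℝ) • B n) f‖ ≤
        ‖B m f - B n f‖ * t :=
    norm_exp_smul_sub_exp_smul_le (hcomm m n) (hexp m) (hexp n) t.2 f
  obtain ⟨S, hS⟩ := ContractionSemigroup.exists_tendsto_op
    (fun n => ContractionSemigroup.ofExp (B n) (hexp n)) hdense (by
      rintro _ ⟨p, hp, rfl⟩ t
      refine cauchySeq_iff_tendsto_dist_atTop_0.2 (squeeze_zero (fun _ => dist_nonneg)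
        (fun n => (dist_eq_norm _ _).trans_le (hdist n.1 n.2 t p.1)) ?_)
      have h := (cauchySeq_iff_tendsto_dist_atTop_0.1 (hB p hp).cauchySeq).mul_const (t : ℝ)
      simpa [dist_eq_norm] using h) (by
      rintro _ ⟨p, hp, rfl⟩
      obtain ⟨C, hC⟩ := (hB p hp).norm.bddAbove_range
      refine ⟨C.toNNReal, fun n => ContractionSemigroup.lipschitzWith_op_apply _ fun t => ?_⟩
      calc _ ≤ ‖B n p.1‖ * t := norm_exp_smul_apply_sub_le (hexp n) t.2 p.1
        _ ≤ C.toNNReal * t := by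
          gcongr
          exact (hC ⟨n, rfl⟩).trans (Real.le_coe_toNNReal C))
  refine ⟨S, fun p hp => ContractionSemigroup.tendsto_inv_smul_of_approx (hB p hp) fun n t => ?_⟩
  exact le_of_tendsto_of_tendsto' ((hS t p.1).sub_const _).norm
    (((hB p hp).sub_const _).norm.mul_const _) fun m => hdist m n t p.1

end CommutingApproximation

section Resolvent

variable {E : Type*} [NormedAddCommGroup E] [NormedSpace ℝ E]

/-- Dissipativity of the operator with graph `G` on a Banach space. -/
def IsDissipative (G : Set (E × E)) : Prop :=
  ∀ p ∈ G, ∀ l : ℝ, 0 < l → l * ‖p.1‖ ≤ ‖l • p.1 - p.2‖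

/-- `R` is the resolvent `(l - G)⁻¹` of the operator with graph `G`. -/
structure IsResolvent (G : Set (E × E)) (l : ℝ) (R : E →L[ℝ] E) : Prop where
  mem : ∀ h, (R h, l • R h - h) ∈ G
  apply_smul_sub : ∀ p ∈ G, R (l • p.1 - p.2) = p.1

/-- The Yosida approximation `l G (l - G)⁻¹` of an operator `G` with resolvent `R` at `l`. -/
def yosida (l : ℝ) (R : E →L[ℝ] E) : E →L[ℝ] E := l • (l • R - 1)

theorem IsDissipative.exists_isResolvent {G : Submodule ℝ (E × E)}
    (hG : IsDissipative (G : Set (E × E))) {l : ℝ} (hl : 0 < l)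
    (hsurj : ∀ h, ∃ p ∈ G, l • p.1 - p.2 = h) : ∃ R, IsResolvent (G : Set (E × E)) l R := by
  let T : G →ₗ[ℝ] E := (l • LinearMap.fst ℝ E E - LinearMap.snd ℝ E E).comp G.subtype
  have hT (p : G) : l * ‖(p : E × E).1‖ ≤ ‖T p‖ := hG p p.2 l hl
  have hinj : Function.Injective T := (injective_iff_map_eq_zero T).2 fun p hp => by
    have hfst : (p : E × E).1 = 0 := norm_le_zero_iff.1 <| nonpos_of_mul_nonpos_right
      ((hT p).trans_eq (by rw [hp, norm_zero])) hl
    have hsnd : l • (p : E × E).1 - (p : E × E).2 = 0 := hp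
    rw [hfst, smul_zero, zero_sub, neg_eq_zero] at hsnd
    exact Subtype.ext (Prod.ext hfst hsnd)
  let e : G ≃ₗ[ℝ] E := LinearEquiv.ofBijective T
    ⟨hinj, fun h => let ⟨p, hp, hph⟩ := hsurj h; ⟨⟨p, hp⟩, hph⟩⟩
  let R : E →L[ℝ] E := ((LinearMap.fst ℝ E E).comp (G.subtype.comp e.symm.toLinearMap)).mkContinuous
    l⁻¹ fun h => by
      rw [inv_mul_eq_div, le_div_iff₀' hl]
      exact (hT (e.symm h)).trans_eq (congrArg norm (e.apply_symm_apply h))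
  refine ⟨R, fun h => ?_, fun p hp => congrArg (·.1.1) (e.symm_apply_apply ⟨p, hp⟩)⟩
  have he : l • R h - (e.symm h : E × E).2 = h := e.apply_symm_apply h
  have hsnd : l • R h - h = (e.symm h : E × E).2 := by
    rw [sub_eq_iff_eq_add', ← sub_eq_iff_eq_add, he]
  exact hsnd ▸ (e.symm h).2

namespace IsResolvent

variable {G : Set (E × E)} {l m : ℝ} {R R' : E →L[ℝ] E}

theorem smul_norm_apply_le (hR : IsResolvent G l R) (hG : IsDissipative G) (hl : 0 < l) (h : E) :
    l * ‖R h‖ ≤ ‖h‖ := by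
  simpa using hG _ (hR.mem h) l hl

theorem norm_smul_le_one (hR : IsResolvent G l R) (hG : IsDissipative G) (hl : 0 < l) :
    ‖l • R‖ ≤ 1 :=
  (l • R).opNorm_le_bound zero_le_one fun h => by
    simpa [norm_smul, abs_of_pos hl] using hR.smul_norm_apply_le hG hl h

theorem sub_eq (hR : IsResolvent G l R) (hR' : IsResolvent G m R') :
    R - R' = (m - l) • (R * R') := by
  ext h
  have key := hR.apply_smul_sub _ (hR'.mem h)
  have harg : l • R' h - (m • R' h - h) = h - (m - l) • R' h := by module
  rw [harg, map_sub, map_smul, sub_eq_iff_eq_add] at key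
  simp [key]

theorem commute (hR : IsResolvent G l R) (hR' : IsResolvent G m R') : Commute R R' := by
  rcases eq_or_ne l m with rfl | hlm
  · rw [sub_eq_zero.1 ((hR.sub_eq hR').trans (by simp))]
  · have h : (m - l) • (R * R') = (m - l) • (R' * R) := by
      rw [← hR.sub_eq hR', ← neg_sub l m, neg_smul, ← hR'.sub_eq hR, neg_sub]
    exact smul_right_injective _ (sub_ne_zero.2 hlm.symm) h

theorem commute_yosida (hR : IsResolvent G l R) (hR' : IsResolvent G m R') :
    Commute (yosida l R) (yosida m R') :=
  .smul_left (.smul_right (((hR.commute hR').smul_left l |>.smul_right m).sub_left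
    (Commute.one_left _) |>.sub_right (Commute.one_right _)) m) l

theorem smul_apply_sub (hR : IsResolvent G l R) {p : E × E} (hp : p ∈ G) :
    l • R p.1 - p.1 = R p.2 := by
  have h := hR.apply_smul_sub p hp
  rwa [map_sub, map_smul, sub_eq_iff_eq_add, ← sub_eq_iff_eq_add'] at h

theorem yosida_apply (hR : IsResolvent G l R) {p : E × E} (hp : p ∈ G) :
    yosida l R p.1 = l • R p.2 := by
  simp [yosida, hR.smul_apply_sub hp]

theorem norm_exp_smul_yosida_le [CompleteSpace E] (hR : IsResolvent G l R) (hG : IsDissipative G)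
    (hl : 0 < l) {t : ℝ} (ht : 0 ≤ t) : ‖NormedSpace.exp (t • yosida l R)‖ ≤ 1 := by
  have hsplit : t • yosida l R = (t * l) • (l • R) + (-(t * l)) • (1 : E →L[ℝ] E) := by
    rw [yosida]; module
  have hone : ‖NormedSpace.exp ((-(t * l)) • (1 : E →L[ℝ] E))‖ ≤ Real.exp (-(t * l)) := by
    rw [← Algebra.algebraMap_eq_smul_one, ← NormedSpace.algebraMap_exp_comm,
      Algebra.algebraMap_eq_smul_one, norm_smul, ← Real.exp_eq_exp_ℝ,
      Real.norm_of_nonneg (Real.exp_pos _).le]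
    exact mul_le_of_le_one_right (Real.exp_pos _).le ContinuousLinearMap.norm_id_le
  have hres : ‖NormedSpace.exp ((t * l) • (l • R))‖ ≤ Real.exp (t * l) := by
    refine (norm_exp_le _).trans (Real.exp_le_exp.2 ?_)
    rw [norm_smul, Real.norm_of_nonneg (by positivity)]
    exact mul_le_of_le_one_right (by positivity) (hR.norm_smul_le_one hG hl)
  rw [hsplit, exp_add_of_commute ((Commute.one_right _).smul_right _)]
  calc _ ≤ Real.exp (t * l) * Real.exp (-(t * l)) := (norm_mul_le _ _).trans (by gcongr)
    _ = 1 := by rw [← Real.exp_add, add_neg_cancel, Real.exp_zero]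

theorem tendsto_smul_apply {l : ℕ → ℝ} {R : ℕ → E →L[ℝ] E}
    (hR : ∀ n, IsResolvent G (l n) (R n)) (hG : IsDissipative G) (hl : ∀ n, 0 < l n)
    (hlim : Tendsto l atTop atTop) (hdense : Dense (Prod.fst '' G)) (f : E) :
    Tendsto (fun n => l n • R n f) atTop (𝓝 f) := by
  have hlip (n : ℕ) : LipschitzWith 1 (l n • R n) :=
    (l n • R n).lipschitz.weaken ((hR n).norm_smul_le_one hG (hl n))
  refine hdense.induction (P := fun f => Tendsto (fun n => l n • R n f) atTop (𝓝 f)) ?_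
    ((LipschitzWith.uniformEquicontinuous _ 1 hlip).equicontinuous.isClosed_setOfPred_tendsto
      continuous_id) f
  rintro _ ⟨p, hp, rfl⟩
  have hnorm (n : ℕ) : ‖l n • R n p.1 - p.1‖ ≤ ‖p.2‖ / l n := by
    rw [(hR n).smul_apply_sub hp, le_div_iff₀' (hl n)]
    exact (hR n).smul_norm_apply_le hG (hl n) _
  exact tendsto_iff_norm_sub_tendsto_zero.2 <|
    squeeze_zero (fun _ => norm_nonneg _) hnorm (hlim.const_div_atTop _)

end IsResolvent

end Resolvent

section HilleYosida

variable {E : Type*} [NormedAddCommGroup E] [NormedSpace ℝ E]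

theorem ContractionSemigroup.isDissipative (S : ContractionSemigroup E) :
    IsDissipative {p : E × E |
      Tendsto (fun t : ℝ≥0 => (t : ℝ)⁻¹ • (S.op t p.1 - p.1)) (𝓝[>] 0) (𝓝 p.2)} := by
  intro p hp l hl
  refine ge_of_tendsto (hp.const_sub (l • p.1)).norm ?_
  filter_upwards [self_mem_nhdsWithin] with t ht
  have ht' : (0 : ℝ) < t := ht
  calc l * ‖p.1‖ ≤ (l + (t : ℝ)⁻¹) * ‖p.1‖ - (t : ℝ)⁻¹ * ‖S.op t p.1‖ := by
        have := mul_le_mul_of_nonneg_left (S.norm_op_apply_le t p.1) (inv_nonneg.2 ht'.le)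
        linarith
    _ = ‖(l + (t : ℝ)⁻¹) • p.1‖ - ‖(t : ℝ)⁻¹ • S.op t p.1‖ := by
        rw [norm_smul, norm_smul, Real.norm_of_nonneg (by positivity),
          Real.norm_of_nonneg (by positivity)]
    _ ≤ ‖(l + (t : ℝ)⁻¹) • p.1 - (t : ℝ)⁻¹ • S.op t p.1‖ := norm_sub_norm_le _ _
    _ = ‖l • p.1 - (t : ℝ)⁻¹ • (S.op t p.1 - p.1)‖ := by
        congr 1; module

theorem IsResolvent.hasGenerator {G : Set (E × E)} {l : ℝ} {R : E →L[ℝ] E}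
    (hR : IsResolvent G l R) (hl : 0 < l) {S : ContractionSemigroup E}
    (hS : ∀ p ∈ G, Tendsto (fun t : ℝ≥0 => (t : ℝ)⁻¹ • (S.op t p.1 - p.1)) (𝓝[>] 0) (𝓝 p.2)) :
    S.HasGenerator G := by
  refine fun f g => ⟨hS (f, g), fun hfg => ?_⟩
  -- A dissipative operator has no proper extension of an operator `G` with `l - G` onto.
  have hmem := hR.mem (l • f - g)
  have hdiff := S.isDissipative (f - R (l • f - g), g - (l • R (l • f - g) - (l • f - g))) (by
    refine (hfg.sub (hS _ hmem)).congr fun t => ?_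
    simp only [map_sub, ← smul_sub]
    congr 1
    abel) l hl
  have hzero : l • (f - R (l • f - g)) - (g - (l • R (l • f - g) - (l • f - g))) = 0 := by module
  rw [hzero, norm_zero] at hdiff
  have hf : R (l • f - g) = f :=
    (sub_eq_zero.1 (norm_le_zero_iff.1 (nonpos_of_mul_nonpos_right hdiff hl))).symm
  simpa [hf] using hmem

theorem IsDissipative.exists_hasGenerator [CompleteSpace E] {G : Submodule ℝ (E × E)}
    (hG : IsDissipative (G : Set (E × E))) (hdense : Dense (Prod.fst '' (G : Set (E × E))))
    {l : ℕ → ℝ} (hl : ∀ n, 0 < l n) (hlim : Tendsto l atTop atTop)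
    (hsurj : ∀ n h, ∃ p ∈ G, l n • p.1 - p.2 = h) :
    ∃ S : ContractionSemigroup E, S.HasGenerator (G : Set (E × E)) := by
  choose R hR using fun n => hG.exists_isResolvent (hl n) (hsurj n)
  have hyosida (p : E × E) (hp : p ∈ G) :
      Tendsto (fun n => yosida (l n) (R n) p.1) atTop (𝓝 p.2) :=
    (IsResolvent.tendsto_smul_apply hR hG hl hlim hdense p.2).congr fun n =>
      ((hR n).yosida_apply hp).symm
  obtain ⟨S, hS⟩ := exists_contractionSemigroup_of_commute
    (fun m n => (hR m).commute_yosida (hR n))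
    (fun n t ht => (hR n).norm_exp_smul_yosida_le hG (hl n) ht) hdense hyosida
  exact ⟨S, (hR 0).hasGenerator (hl 0) hS⟩

end HilleYosida

/-! ## Orbits of a contraction semigroup -/

theorem tendsto_toNNReal_nhdsGT_zero :
    Tendsto Real.toNNReal (𝓝[>] 0) (𝓝[>] 0) :=
  tendsto_nhdsWithin_iff.2 ⟨(continuous_real_toNNReal.tendsto' 0 0 Real.toNNReal_zero).mono_left
    nhdsWithin_le_nhds, eventually_nhdsWithin_of_forall fun _ ht => Real.toNNReal_pos.2 ht⟩

namespace ContractionSemigroup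

theorem continuous_op_toNNReal {E : Type*} [NormedAddCommGroup E] [NormedSpace ℝ E]
    (S : ContractionSemigroup E) (f : E) : Continuous fun t : ℝ => S.op t.toNNReal f :=
  (S.continuous_op f).comp continuous_real_toNNReal

theorem op_integral {E : Type*} [NormedAddCommGroup E] [NormedSpace ℝ E] [CompleteSpace E]
    (S : ContractionSemigroup E) (f : E) {s : ℝ} (hs : 0 ≤ s) (t : ℝ≥0) :
    S.op t (∫ r in (0 : ℝ)..s, S.op r.toNNReal f) =
      (∫ r in (0 : ℝ)..(s + t), S.op r.toNNReal f) - ∫ r in (0 : ℝ)..t, S.op r.toNNReal f := by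
  have hint (a b : ℝ) : IntervalIntegrable (fun r : ℝ => S.op r.toNNReal f) volume a b :=
    (S.continuous_op_toNNReal f).intervalIntegrable a b
  have hshift : ∫ r in (0 : ℝ)..s, S.op t (S.op r.toNNReal f) =
      ∫ r in (0 : ℝ)..s, S.op (r + t).toNNReal f := by
    refine intervalIntegral.integral_congr fun r hr => ?_
    rw [Set.uIcc_of_le hs] at hr
    rw [← S.op_add_apply, Real.toNNReal_add hr.1 t.coe_nonneg, Real.toNNReal_coe, add_comm]
  rw [← ContinuousLinearMap.intervalIntegral_comp_comm _ (hint 0 s), hshift,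
    intervalIntegral.integral_comp_add_right (fun r : ℝ => S.op r.toNNReal f), zero_add,
    intervalIntegral.integral_interval_sub_left (hint _ _) (hint _ _)]

namespace HasGenerator

section Orbit

variable {E : Type*} [NormedAddCommGroup E] [NormedSpace ℝ E]
  {S : ContractionSemigroup E} {G : Set (E × E)}

theorem op_mem (hS : S.HasGenerator G) {f g : E} (h : (f, g) ∈ G) (s : ℝ≥0) :
    (S.op s f, S.op s g) ∈ G := by
  rw [hS]
  refine (((S.op s).continuous.tendsto g).comp ((hS f g).1 h)).congr fun t => ?_
  simp only [Function.comp_apply, map_smul, map_sub, ← S.op_add_apply, add_comm]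

theorem hasDerivWithinAt (hS : S.HasGenerator G) {f g : E} (h : (f, g) ∈ G) {s : ℝ}
    (hs : 0 ≤ s) :
    HasDerivWithinAt (fun t : ℝ => S.op t.toNNReal f) (S.op s.toNNReal g) (Set.Ioi s) s := by
  have hslope := ((hS _ _).1 (hS.op_mem h s.toNNReal)).comp tendsto_toNNReal_nhdsGT_zero
  have hshift : Tendsto (fun t : ℝ => t - s) (𝓝[>] s) (𝓝[>] 0) :=
    tendsto_nhdsWithin_iff.2
      ⟨((continuous_sub_right s).tendsto' s 0 (sub_self s)).mono_left nhdsWithin_le_nhds,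
        eventually_nhdsWithin_of_forall fun _ ht => Set.mem_Ioi.2 (sub_pos.2 ht)⟩
  rw [hasDerivWithinAt_iff_tendsto_slope' (by simp)]
  refine (hslope.comp hshift).congr' (eventually_nhdsWithin_of_forall fun t (ht : s < t) => ?_)
  simp only [Function.comp_apply, slope_def_module]
  rw [Real.coe_toNNReal _ (sub_nonneg.2 ht.le), ← S.op_add_apply,
    ← Real.toNNReal_add (sub_nonneg.2 ht.le) hs, sub_add_cancel]

variable [CompleteSpace E]

theorem integral_eq_sub (hS : S.HasGenerator G) {f g : E} (h : (f, g) ∈ G) {s : ℝ}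
    (hs : 0 ≤ s) : ∫ t in (0 : ℝ)..s, S.op t.toNNReal g = S.op s.toNNReal f - f := by
  simpa [S.op_zero] using intervalIntegral.integral_eq_sub_of_hasDeriv_right_of_le hs
    (S.continuous_op_toNNReal f).continuousOn (fun t ht => hS.hasDerivWithinAt h ht.1.le)
    ((S.continuous_op_toNNReal g).intervalIntegrable _ _)

theorem hasDerivAt (hS : S.HasGenerator G) {f g : E} (h : (f, g) ∈ G) {s : ℝ} (hs : 0 < s) :
    HasDerivAt (fun t : ℝ => S.op t.toNNReal f) (S.op s.toNNReal g) s := by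
  refine (((S.continuous_op_toNNReal g).integral_hasStrictDerivAt 0 s).hasDerivAt.const_add
    f).congr_of_eventuallyEq ?_
  filter_upwards [lt_mem_nhds hs] with t ht
  rw [hS.integral_eq_sub h ht.le, add_sub_cancel]

theorem integral_mem (hS : S.HasGenerator G) (f : E) {s : ℝ} (hs : 0 ≤ s) :
    (∫ t in (0 : ℝ)..s, S.op t.toNNReal f, S.op s.toNNReal f - f) ∈ G := by
  have hslope (x : ℝ) := ((S.continuous_op_toNNReal f).integral_hasStrictDerivAt 0
    x).hasDerivAt.tendsto_slope_zero_right.comp tendsto_coe_nhdsGT_zero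
  have hlim := (hslope s).sub (hslope 0)
  simp only [Real.toNNReal_zero, S.op_zero_apply] at hlim
  refine (hS _ _).2 (hlim.congr fun t => ?_)
  simp only [Function.comp_apply, ← smul_sub, S.op_integral f hs t, zero_add,
    intervalIntegral.integral_same, sub_zero]
  congr 1
  abel

end Orbit

end HasGenerator

/-! ## Symmetric semigroups -/

section Symmetric

variable {H : Type*} [NormedAddCommGroup H] [InnerProductSpace ℝ H]

/-- A semigroup of symmetric operators. -/
def IsSymmetric (S : ContractionSemigroup H) : Prop :=
  ∀ t f h, inner ℝ (S.op t f) h = inner ℝ f (S.op t h)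

theorem continuous_inner_op (S : ContractionSemigroup H) (f h : H) :
    Continuous fun t : ℝ => inner ℝ f (S.op t.toNNReal h) :=
  continuous_const.inner (S.continuous_op_toNNReal h)

theorem integral_inner_op_sum_smul {ι : Type*} [Fintype ι] (S : ContractionSemigroup H)
    {j : ι → H} (hj : ∀ i k, IntegrableOn (fun t : ℝ => inner ℝ (j i) (S.op t.toNNReal (j k)))
      (Set.Ioi 0)) (u : ι → ℝ) :
    ∫ t in Set.Ioi (0 : ℝ), inner ℝ (∑ i, u i • j i) (S.op t.toNNReal (∑ k, u k • j k)) =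
      ∑ i, ∑ k, u i * u k * ∫ t in Set.Ioi (0 : ℝ), inner ℝ (j i) (S.op t.toNNReal (j k)) := by
  have hint := fun i k => (hj i k).const_mul (u i * u k)
  simp only [map_sum, map_smul, sum_inner, real_inner_smul_left]
  simp only [inner_sum, real_inner_smul_right, Finset.mul_sum, ← mul_assoc]
  rw [integral_finsetSum _ fun i _ => integrable_finsetSum _ fun k _ => hint i k]
  simp_rw [fun i => integral_finsetSum Finset.univ fun k _ => hint i k, integral_const_mul]

namespace IsSymmetric

variable {S : ContractionSemigroup H}

theorem inner_op_add (hS : S.IsSymmetric) (s t : ℝ≥0) (f h : H) :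
    inner ℝ f (S.op (s + t) h) = inner ℝ (S.op s f) (S.op t h) := by
  rw [S.op_add_apply, hS]

theorem inner_op_self (hS : S.IsSymmetric) (t : ℝ≥0) (f : H) :
    inner ℝ f (S.op t f) = ‖S.op (t / 2) f‖ ^ 2 := by
  rw [← real_inner_self_eq_norm_sq, ← hS.inner_op_add, add_halves]

theorem inner_op_self_nonneg (hS : S.IsSymmetric) (t : ℝ≥0) (f : H) :
    0 ≤ inner ℝ f (S.op t f) :=
  hS.inner_op_self t f ▸ sq_nonneg _

theorem two_mul_abs_inner_op_le (hS : S.IsSymmetric) (t : ℝ≥0) (f h : H) :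
    2 * |inner ℝ f (S.op t h)| ≤ inner ℝ f (S.op t f) + inner ℝ h (S.op t h) := by
  rw [hS.inner_op_self, hS.inner_op_self]
  nth_rw 1 [← add_halves t]
  rw [hS.inner_op_add]
  have hcs := abs_real_inner_le_norm (S.op (t / 2) f) (S.op (t / 2) h)
  linarith [two_mul_le_add_sq ‖S.op (t / 2) f‖ ‖S.op (t / 2) h‖]

theorem integrableOn_inner_op (hS : S.IsSymmetric) {f h : H}
    (hf : IntegrableOn (fun t : ℝ => inner ℝ f (S.op t.toNNReal f)) (Set.Ioi 0))
    (hh : IntegrableOn (fun t : ℝ => inner ℝ h (S.op t.toNNReal h)) (Set.Ioi 0)) :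
    IntegrableOn (fun t : ℝ => inner ℝ f (S.op t.toNNReal h)) (Set.Ioi 0) := by
  refine (hf.add hh).mono' (S.continuous_inner_op f h).aestronglyMeasurable.restrict
    (.of_forall fun t => ?_)
  have h2 := hS.two_mul_abs_inner_op_le t.toNNReal f h
  rw [Real.norm_eq_abs, Pi.add_apply]
  linarith [abs_nonneg (inner ℝ f (S.op t.toNNReal h))]

variable [CompleteSpace H] {G : Set (H × H)} {j : H} {c : ℝ}

theorem intervalIntegral_inner_op_self_le (hsymm : S.IsSymmetric) (hS : S.HasGenerator G)
    (hc : 0 ≤ c) (hj : ∀ p ∈ G, inner ℝ j p.1 ^ 2 ≤ c * -inner ℝ p.1 p.2) {s : ℝ} (hs : 0 ≤ s) :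
    ∫ t in (0 : ℝ)..s, inner ℝ j (S.op t.toNNReal j) ≤ c := by
  -- The bound is applied to `F = ∫_0^s S_t j`, for which `-G F = j - S_s j`.
  set F := ∫ t in (0 : ℝ)..s, S.op t.toNNReal j
  have hinner (h : H) : inner ℝ h F = ∫ t in (0 : ℝ)..s, inner ℝ h (S.op t.toNNReal j) :=
    ((innerSL ℝ h).intervalIntegral_comp_comm
      ((S.continuous_op_toNNReal j).intervalIntegrable _ _)).symm
  have hend : 0 ≤ inner ℝ F (S.op s.toNNReal j) := by
    rw [real_inner_comm, hinner]
    refine intervalIntegral.integral_nonneg hs fun t _ => ?_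
    rw [← hsymm.inner_op_add]
    exact hsymm.inner_op_self_nonneg _ _
  have hsq := hj _ (hS.integral_mem j hs)
  rw [inner_sub_right, real_inner_comm j F] at hsq
  rw [← hinner]
  nlinarith [mul_nonneg hc hend]

theorem integrableOn_inner_op_self (hsymm : S.IsSymmetric) (hS : S.HasGenerator G)
    (hc : 0 ≤ c) (hj : ∀ p ∈ G, inner ℝ j p.1 ^ 2 ≤ c * -inner ℝ p.1 p.2) :
    IntegrableOn (fun t : ℝ => inner ℝ j (S.op t.toNNReal j)) (Set.Ioi 0) := by
  refine integrableOn_Ioi_of_intervalIntegral_norm_bounded c 0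
    (fun n : ℕ => ((S.continuous_inner_op j j).intervalIntegrable 0 n).1)
    tendsto_natCast_atTop_atTop (.of_forall fun n => ?_)
  simp only [Real.norm_of_nonneg (hsymm.inner_op_self_nonneg _ _)]
  exact hsymm.intervalIntegral_inner_op_self_le hS hc hj n.cast_nonneg

theorem integral_Ioi_inner_op_self_le (hsymm : S.IsSymmetric) (hS : S.HasGenerator G)
    (hc : 0 ≤ c) (hj : ∀ p ∈ G, inner ℝ j p.1 ^ 2 ≤ c * -inner ℝ p.1 p.2) :
    ∫ t in Set.Ioi (0 : ℝ), inner ℝ j (S.op t.toNNReal j) ≤ c :=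
  le_of_tendsto (intervalIntegral_tendsto_integral_Ioi 0
    (hsymm.integrableOn_inner_op_self hS hc hj) tendsto_id)
    ((eventually_ge_atTop 0).mono fun _ hs => hsymm.intervalIntegral_inner_op_self_le hS hc hj hs)

end IsSymmetric

theorem HasGenerator.isSymmetric [CompleteSpace H] {S : ContractionSemigroup H}
    {G : Set (H × H)} (hS : S.HasGenerator G) (hdense : Dense (Prod.fst '' G))
    (hsymm : ∀ p ∈ G, ∀ p' ∈ G, inner ℝ p.2 p'.1 = inner ℝ p.1 p'.2) : S.IsSymmetric := by
  intro t
  -- `s ↦ ⟪S_s f, S_{t-s} h⟫` is constant on `[0, t]` for `f` and `h` in the domain.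
  have hdomain : ∀ p ∈ G, ∀ p' ∈ G, inner ℝ (S.op t p.1) p'.1 = inner ℝ p.1 (S.op t p'.1) := by
    intro p hp p' hp'
    have hderiv (s : ℝ) (hs : s ∈ Set.Ioo 0 (t : ℝ)) :
        HasDerivAt (fun s : ℝ => inner ℝ (S.op s.toNNReal p.1) (S.op (t - s).toNNReal p'.1))
          0 s := by
      have hcancel : inner ℝ (S.op s.toNNReal p.1) ((-1 : ℝ) • S.op (t - s).toNNReal p'.2) +
          inner ℝ (S.op s.toNNReal p.2) (S.op (t - s).toNNReal p'.1) = 0 := by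
        rw [hsymm _ (hS.op_mem hp s.toNNReal) _ (hS.op_mem hp' (t - s).toNNReal), neg_one_smul,
          inner_neg_right, neg_add_cancel]
      exact hcancel ▸ (hS.hasDerivAt hp hs.1).inner ℝ ((hS.hasDerivAt hp' (sub_pos.2 hs.2)).scomp s
        ((hasDerivAt_id s).const_sub (t : ℝ)))
    have hconst := intervalIntegral.integral_eq_sub_of_hasDerivAt_of_le t.2
      ((S.continuous_op_toNNReal p.1).inner ((S.continuous_op_toNNReal p'.1).comp
        (continuous_sub_left _))).continuousOn hderiv intervalIntegrable_const
    simpa [S.op_zero_apply, sub_eq_zero] using hconst.symm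
  refine fun f h => hdense.induction (P := fun f => inner ℝ (S.op t f) h = inner ℝ f (S.op t h)) ?_
    (isClosed_eq (by fun_prop) (by fun_prop)) f
  rintro _ ⟨p, hp, rfl⟩
  refine hdense.induction (P := fun h => inner ℝ (S.op t p.1) h = inner ℝ p.1 (S.op t h)) ?_
    (isClosed_eq (by fun_prop) (by fun_prop)) h
  rintro _ ⟨p', hp', rfl⟩
  exact hdomain p hp p' hp'

end Symmetric

end ContractionSemigroup

/-! ## Operators given on a core -/

section Core

variable {V H : Type*} [AddCommGroup V] [Module ℝ V] [NormedAddCommGroup H] [InnerProductSpace ℝ H]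
  {ι T A B : V →ₗ[ℝ] H} {l c : ℝ}

theorem isDissipative_of_inner_nonpos {G : Set (H × H)} (hG : ∀ p ∈ G, inner ℝ p.1 p.2 ≤ 0) :
    IsDissipative G := by
  intro p hp l _
  have h : l * ‖p.1‖ * ‖p.1‖ ≤ ‖p.1‖ * ‖l • p.1 - p.2‖ :=
    calc l * ‖p.1‖ * ‖p.1‖ = l * inner ℝ p.1 p.1 := by
          rw [real_inner_self_eq_norm_mul_norm, mul_assoc]
      _ ≤ l * inner ℝ p.1 p.1 - inner ℝ p.1 p.2 := by linarith [hG p hp]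
      _ = inner ℝ p.1 (l • p.1 - p.2) := by rw [inner_sub_right, real_inner_smul_right]
      _ ≤ ‖p.1‖ * ‖l • p.1 - p.2‖ := real_inner_le_norm _ _
  rcases (norm_nonneg p.1).eq_or_lt with h0 | h0
  · rw [← h0, mul_zero]
    exact norm_nonneg _
  · exact le_of_mul_le_mul_left (by linarith) h0

theorem IsDissipative.isClosed_image_smul_sub {E : Type*} [NormedAddCommGroup E] [NormedSpace ℝ E]
    [CompleteSpace E] {G : Submodule ℝ (E × E)} (hG : IsDissipative (G : Set (E × E)))
    (hcl : IsClosed (G : Set (E × E))) (hl : 0 < l) :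
    IsClosed ((fun p : E × E => l • p.1 - p.2) '' G) := by
  have : CompleteSpace G := hcl.completeSpace_coe
  let Φ : G →L[ℝ] E := (l • ContinuousLinearMap.fst ℝ E E - ContinuousLinearMap.snd ℝ E E).comp
    G.subtypeL
  have hΦ : AntilipschitzWith (l⁻¹ + 2).toNNReal Φ := by
    refine ContinuousLinearMap.antilipschitz_of_bound _ fun ⟨p, hp⟩ => ?_
    rw [Real.coe_toNNReal _ (by positivity)]
    change ‖p‖ ≤ (l⁻¹ + 2) * ‖l • p.1 - p.2‖
    have hfst : l * ‖p.1‖ ≤ ‖l • p.1 - p.2‖ := hG p hp l hl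
    have hsnd : ‖p.2‖ ≤ l * ‖p.1‖ + ‖l • p.1 - p.2‖ := by
      simpa [norm_smul, abs_of_pos hl] using norm_sub_le (l • p.1) (l • p.1 - p.2)
    have h0 : 0 ≤ l⁻¹ * ‖l • p.1 - p.2‖ := by positivity
    refine max_le ?_ (by linarith)
    have : ‖p.1‖ ≤ l⁻¹ * ‖l • p.1 - p.2‖ := by rwa [inv_mul_eq_div, le_div_iff₀' hl]
    linarith [norm_nonneg (l • p.1 - p.2)]
  have hrange : (fun p : E × E => l • p.1 - p.2) '' G = Set.range Φ := by
    ext h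
    simp [Φ]
  exact hrange ▸ hΦ.isClosed_range Φ.uniformContinuous

variable (ι T) in
/-- The graph of the closure of the operator that maps `ι f` to `T f`, where `ι` embeds a space of
test functions (a core) into the Hilbert space. -/
def coreGraph : Submodule ℝ (H × H) := (LinearMap.range (ι.prod T)).topologicalClosure

theorem coreGraph_induction {P : H × H → Prop} (hP : IsClosed {p | P p})
    (h : ∀ f, P (ι f, T f)) : ∀ p ∈ coreGraph ι T, P p :=
  closure_minimal (by rintro _ ⟨f, rfl⟩; exact h f) hP

theorem mem_coreGraph (f : V) : (ι f, T f) ∈ coreGraph ι T :=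
  subset_closure ⟨f, rfl⟩

theorem dense_fst_coreGraph (hι : DenseRange ι) :
    Dense (Prod.fst '' (coreGraph ι T : Set (H × H))) :=
  Dense.mono (by rintro _ ⟨f, rfl⟩; exact ⟨_, mem_coreGraph f, rfl⟩) hι

theorem inner_snd_fst_of_mem_coreGraph (hT : ∀ f g, inner ℝ (T f) (ι g) = inner ℝ (ι f) (T g)) :
    ∀ p ∈ coreGraph ι T, ∀ p' ∈ coreGraph ι T, inner ℝ p.2 p'.1 = inner ℝ p.1 p'.2 := fun p hp =>
  coreGraph_induction (isClosed_eq (by fun_prop) (by fun_prop)) fun g =>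
    coreGraph_induction (P := fun p => inner ℝ p.2 (ι g) = inner ℝ p.1 (T g))
      (isClosed_eq (by fun_prop) (by fun_prop)) (fun f => hT f g) p hp

theorem inner_nonpos_of_mem_coreGraph (hT : ∀ f, inner ℝ (ι f) (T f) ≤ 0) :
    ∀ p ∈ coreGraph ι T, inner ℝ p.1 p.2 ≤ 0 :=
  coreGraph_induction (isClosed_le (by fun_prop) (by fun_prop)) hT

theorem exists_mem_coreGraph_smul_sub_eq [CompleteSpace H] (hT : ∀ f, inner ℝ (ι f) (T f) ≤ 0)
    (hl : 0 < l) (hrange : DenseRange (l • ι - T)) (h : H) :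
    ∃ p ∈ coreGraph ι T, l • p.1 - p.2 = h := by
  have hcl := (isDissipative_of_inner_nonpos (inner_nonpos_of_mem_coreGraph hT)
    ).isClosed_image_smul_sub (Submodule.isClosed_topologicalClosure _) hl
  refine hcl.closure_subset_iff.2 ?_ (hrange h)
  rintro _ ⟨f, rfl⟩
  exact ⟨_, mem_coreGraph f, rfl⟩

theorem exists_hasGenerator_coreGraph [CompleteSpace H] (hι : DenseRange ι)
    (hT : ∀ f, inner ℝ (ι f) (T f) ≤ 0) (hrange : ∀ᶠ l : ℝ in atTop, DenseRange (l • ι - T)) :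
    ∃ S : ContractionSemigroup H, S.HasGenerator (coreGraph ι T : Set (H × H)) := by
  obtain ⟨l₀, hl₀⟩ := eventually_atTop.1 (hrange.and (eventually_gt_atTop 0))
  have hl (n : ℕ) := hl₀ (n + l₀) (by simp)
  exact (isDissipative_of_inner_nonpos (inner_nonpos_of_mem_coreGraph hT)).exists_hasGenerator
    (dense_fst_coreGraph hι) (fun n => (hl n).2)
    (tendsto_atTop_add_const_right _ _ tendsto_natCast_atTop_atTop)
    fun n => exists_mem_coreGraph_smul_sub_eq hT (hl n).2 (hl n).1

theorem denseRange_smul_sub_add [CompleteSpace H] (hA : ∀ f, inner ℝ (ι f) (A f) ≤ 0)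
    (hB : ∀ f, ‖B f‖ ≤ c * ‖ι f‖) (hl : 0 < l) (hcl : c < l)
    (hrange : DenseRange (l • ι - A)) : DenseRange (l • ι - (A + B)) := by
  rw [DenseRange, ← LinearMap.coe_range, Submodule.dense_iff_topologicalClosure_eq_top,
    Submodule.topologicalClosure_eq_top_iff, Submodule.eq_bot_iff]
  intro h hh
  have hdiss (f : V) : l * ‖ι f‖ ≤ ‖l • ι f - A f‖ :=
    isDissipative_of_inner_nonpos (G := Set.range (ι.prod A)) (by rintro _ ⟨f, rfl⟩; exact hA f)
      _ ⟨f, rfl⟩ l hl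
  have hbound (f : V) : l * inner ℝ (l • ι f - A f) h ≤ max c 0 * ‖l • ι f - A f‖ * ‖h‖ := by
    have horth : inner ℝ (l • ι f - A f) h = inner ℝ (B f) h := by
      have := (Submodule.mem_orthogonal _ _).1 hh _ ⟨f, rfl⟩
      rwa [LinearMap.sub_apply, LinearMap.add_apply, ← sub_sub, inner_sub_left,
        sub_eq_zero] at this
    have hBf : ‖B f‖ ≤ max c 0 * ‖ι f‖ := (hB f).trans (by gcongr; exact le_max_left _ _)
    calc l * inner ℝ (l • ι f - A f) h ≤ l * (max c 0 * ‖ι f‖ * ‖h‖) := by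
          rw [horth]
          gcongr
          exact (real_inner_le_norm _ _).trans (by gcongr)
      _ = max c 0 * (l * ‖ι f‖) * ‖h‖ := by ring
      _ ≤ max c 0 * ‖l • ι f - A f‖ * ‖h‖ := by gcongr; exact hdiss f
  have hall : l * inner ℝ h h ≤ max c 0 * ‖h‖ * ‖h‖ :=
    hrange.induction_on (p := fun k => l * inner ℝ k h ≤ max c 0 * ‖k‖ * ‖h‖) h
      (isClosed_le (by fun_prop) (by fun_prop)) hbound
  rw [real_inner_self_eq_norm_mul_norm] at hall
  by_contra hne
  nlinarith [mul_pos (norm_pos_iff.2 hne) (norm_pos_iff.2 hne), max_lt hcl hl]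

end Core

variable {d : ℕ}

/-! ## Local functions -/

theorem IsLocal.map₂ {f g : Config d → ℝ} (hf : IsLocal f) (hg : IsLocal g) (φ : ℝ → ℝ → ℝ) :
    IsLocal fun η => φ (f η) (g η) := by
  classical
  obtain ⟨A, hA⟩ := hf
  obtain ⟨B, hB⟩ := hg
  refine ⟨A ∪ B, fun η η' h => ?_⟩
  rw [Finset.coe_union] at h
  exact congrArg₂ φ (hA fun x hx => h x (.inl hx)) (hB fun x hx => h x (.inr hx))

variable (d) in
/-- The algebra of local functions, on which the generators are initially defined. -/
def localFun : Subalgebra ℝ (Config d → ℝ) where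
  carrier := {f | IsLocal f}
  mul_mem' hf hg := hf.map₂ hg (· * ·)
  add_mem' hf hg := hf.map₂ hg (· + ·)
  algebraMap_mem' _ := ⟨∅, fun _ _ _ => rfl⟩

namespace localFun

instance : CoeFun (localFun d) fun _ => Config d → ℝ := ⟨Subtype.val⟩

theorem finite_range (f : localFun d) : (Set.range (f : Config d → ℝ)).Finite := by
  obtain ⟨A, hA⟩ := f.2
  obtain ⟨g, hg⟩ := dependsOn_iff_exists_comp.1 hA
  rw [hg]
  exact (Set.finite_range g).subset (Set.range_comp_subset_range _ _)

theorem measurable (f : localFun d) : Measurable (f : Config d → ℝ) := by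
  obtain ⟨A, hA⟩ := f.2
  obtain ⟨g, hg⟩ := dependsOn_iff_exists_comp.1 hA
  rw [hg]
  exact (measurable_of_countable (g : (A → Bool) → ℝ)).comp (A.measurable_restrict)

theorem memLp (f : localFun d) (p : ℝ≥0∞) (μ : Measure (Config d)) [IsFiniteMeasure μ] :
    MemLp f p μ := by
  obtain ⟨C, hC⟩ := (finite_range f).isBounded.exists_norm_le
  exact MemLp.of_bound (measurable f).aestronglyMeasurable C
    (Eventually.of_forall fun η => hC _ ⟨η, rfl⟩)

theorem integrable (f : localFun d) (μ : Measure (Config d)) [IsFiniteMeasure μ] :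
    Integrable f μ :=
  memLp_one_iff_integrable.1 (memLp f 1 μ)

/-- Composition with a map of configurations each of whose coordinates is local. -/
def pullback (φ : Config d → Config d)
    (hφ : ∀ x, ∃ A : Finset (Site d), DependsOn (fun η => φ η x) (A : Set (Site d))) :
    localFun d →ₐ[ℝ] localFun d where
  toFun f := ⟨f ∘ φ, by
    classical
    obtain ⟨A, hA⟩ := f.2
    choose B hB using hφ
    refine ⟨A.biUnion B, fun η η' h => hA fun x hx => hB x fun y hy => h y ?_⟩
    exact Finset.mem_biUnion.2 ⟨x, hx, hy⟩⟩
  map_one' := rfl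
  map_mul' _ _ := rfl
  map_zero' := rfl
  map_add' _ _ := rfl
  commutes' _ := rfl

theorem dependsOn_update (x : Site d) (b : Bool) (y : Site d) :
    DependsOn (fun η : Config d => Function.update η x b y) {y} := fun η η' h => by
  rcases eq_or_ne y x with rfl | hy
  · simp
  · simp [Function.update_of_ne hy, h y rfl]

/-- Substitution of the value `b` for the occupation variable at `x`. -/
def substAt (x : Site d) (b : Bool) : localFun d →ₐ[ℝ] localFun d :=
  pullback (Function.update · x b) fun y => ⟨{y}, by simpa using dependsOn_update x b y⟩

/-- Translation, `f ↦ f(η_{z+·})`. -/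
def translation (z : Site d) : localFun d →ₐ[ℝ] localFun d :=
  pullback (shift z) fun x => ⟨{z + x}, fun _ _ h => h _ (by simp)⟩

@[simp] theorem substAt_apply (x : Site d) (b : Bool) (f : localFun d) (η : Config d) :
    substAt x b f η = f (Function.update η x b) := rfl

@[simp] theorem translation_apply (z : Site d) (f : localFun d) (η : Config d) :
    translation z f η = f (shift z η) := rfl

/-- The expectation of a local function. -/
def mean (q : I) : localFun d →ₗ[ℝ] ℝ where
  toFun f := ∫ η, f η ∂(mu d q)
  map_add' f g := integral_add (integrable f _) (integrable g _)
  map_smul' c f := integral_const_mul c f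

theorem mean_apply (q : I) (f : localFun d) : mean q f = ∫ η, f η ∂(mu d q) := rfl

theorem mean_one (q : I) : mean q (1 : localFun d) = 1 := by simp [mean_apply]

theorem mean_mono (q : I) {f g : localFun d} (h : ∀ η, f η ≤ g η) : mean q f ≤ mean q g :=
  integral_mono (integrable f _) (integrable g _) h

theorem mean_nonneg (q : I) {f : localFun d} (h : ∀ η, 0 ≤ f η) : 0 ≤ mean q f :=
  integral_nonneg h

end localFun

/-! ## Translation and resampling of the product measure -/

theorem measurePreserving_shift (q : I) (z : Site d) :
    MeasurePreserving (shift z) (mu d q) (mu d q) :=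
  ⟨by unfold shift; fun_prop, Measure.map_infinitePi_infinitePi_of_inj
    (P := fun _ : Site d => ProbabilityTheory.bernoulliMeasure false true q)
    (f := fun x => z + x) (add_right_injective z)⟩

theorem measurable_update_prod (x : Site d) :
    Measurable fun p : Config d × Bool => Function.update p.1 x p.2 := by
  refine measurable_pi_lambda _ fun a => ?_
  rcases eq_or_ne a x with rfl | h
  · simpa using measurable_snd
  · simp only [Function.update_of_ne h]; fun_prop

open Classical in
theorem update_prod_preimage_pi (x : Site d) (s : Finset (Site d)) (t : Site d → Set Bool) :
    (fun p : Config d × Bool => Function.update p.1 x p.2) ⁻¹' (s : Set (Site d)).pi t =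
      ((s.erase x : Finset (Site d)) : Set (Site d)).pi t ×ˢ
        (if x ∈ s then t x else Set.univ) := by
  ext p
  simp only [Set.mem_preimage, Set.mem_pi, Set.mem_prod, Finset.mem_coe, Finset.mem_erase]
  constructor
  · refine fun h => ⟨fun i hi => by simpa [Function.update_of_ne hi.1] using h i hi.2, ?_⟩
    split_ifs with hx
    · simpa using h x hx
    · trivial
  · rintro ⟨hp, hx⟩ i hi
    rcases eq_or_ne i x with rfl | h
    · simpa [hi] using hx
    · simpa [Function.update_of_ne h] using hp i ⟨h, hi⟩

theorem measurePreserving_update (q : I) (x : Site d) :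
    MeasurePreserving (fun p : Config d × Bool => Function.update p.1 x p.2)
      ((mu d q).prod (ProbabilityTheory.bernoulliMeasure false true q)) (mu d q) := by
  classical
  refine ⟨measurable_update_prod x, Measure.eq_infinitePi _ fun s t ht => ?_⟩
  rw [Measure.map_apply (measurable_update_prod x) (.pi s.countable_toSet fun i _ => ht i),
    update_prod_preimage_pi, Measure.prod_prod, mu, Measure.infinitePi_pi _ fun i _ => ht i]
  split_ifs with hx
  · rw [mul_comm, Finset.mul_prod_erase s (fun i =>
      ProbabilityTheory.bernoulliMeasure false true q (t i)) hx]
  · rw [Finset.erase_eq_of_notMem hx, measure_univ, mul_one]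

namespace localFun

theorem integral_comp (q : I) {α : Type*} [MeasurableSpace α] {ν : Measure α} {φ : α → Config d}
    (hφ : MeasurePreserving φ ν (mu d q)) (f : localFun d) : ∫ a, f (φ a) ∂ν = mean q f := by
  rw [mean_apply, ← hφ.map_eq,
    integral_map_of_stronglyMeasurable hφ.measurable (measurable f).stronglyMeasurable]

theorem mean_translation (q : I) (z : Site d) (f : localFun d) :
    mean q (translation z f) = mean q f :=
  integral_comp q (measurePreserving_shift q z) f

/-- The conditional expectation of a local function given all coordinates except the one
at `x`. -/
def resample (q : I) (x : Site d) : localFun d →ₗ[ℝ] localFun d :=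
  (q : ℝ) • (substAt x false).toLinearMap + (1 - (q : ℝ)) • (substAt x true).toLinearMap

/-- The deviation of a local function from its conditional expectation given all coordinates
except the one at `x`. -/
def siteGrad (q : I) (x : Site d) : localFun d →ₗ[ℝ] localFun d := LinearMap.id - resample q x

theorem resample_apply (q : I) (x : Site d) (f : localFun d) :
    resample q x f = (q : ℝ) • substAt x false f + (1 - (q : ℝ)) • substAt x true f := rfl

theorem siteGrad_apply (q : I) (x : Site d) (f : localFun d) :
    siteGrad q x f = f - resample q x f := rfl

theorem mean_resample (q : I) (x : Site d) (f : localFun d) :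
    mean q (resample q x f) = mean q f := by
  have hφ := measurePreserving_update q x
  obtain ⟨C, hC⟩ := (finite_range f).isBounded.exists_norm_le
  have hint : Integrable (fun p : Config d × Bool => f (Function.update p.1 x p.2))
      ((mu d q).prod (ProbabilityTheory.bernoulliMeasure false true q)) :=
    Integrable.of_bound ((measurable f).comp hφ.measurable).aestronglyMeasurable C
      (Eventually.of_forall fun p => hC _ ⟨_, rfl⟩)
  rw [← integral_comp q hφ f, integral_prod _ hint]
  simp only [ProbabilityTheory.integral_bernoulliMeasure]
  rfl

theorem substAt_substAt (x : Site d) (b b' : Bool) (f : localFun d) :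
    substAt x b (substAt x b' f) = substAt x b' f := by
  ext η; simp

theorem substAt_resample (q : I) (x : Site d) (b : Bool) (f : localFun d) :
    substAt x b (resample q x f) = resample q x f := by
  simp only [resample_apply, map_add, map_smul, substAt_substAt]

theorem resample_of_substAt (q : I) {x : Site d} {f : localFun d}
    (hf : ∀ b, substAt x b f = f) : resample q x f = f := by
  rw [resample_apply, hf, hf, ← add_smul, add_sub_cancel, one_smul]

theorem resample_mul_left (q : I) {x : Site d} {k : localFun d} (hk : ∀ b, substAt x b k = k)
    (f : localFun d) : resample q x (k * f) = k * resample q x f := by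
  simp only [resample_apply, map_mul, hk, mul_add, mul_smul_comm]

theorem siteGrad_mul_left (q : I) {x : Site d} {k : localFun d} (hk : ∀ b, substAt x b k = k)
    (f : localFun d) : siteGrad q x (k * f) = k * siteGrad q x f := by
  rw [siteGrad_apply, resample_mul_left q hk, siteGrad_apply, mul_sub]

theorem siteGrad_of_substAt (q : I) {x : Site d} {f : localFun d}
    (hf : ∀ b, substAt x b f = f) : siteGrad q x f = 0 := by
  rw [siteGrad_apply, resample_of_substAt q hf, sub_self]

theorem resample_siteGrad (q : I) (x : Site d) (f : localFun d) :
    resample q x (siteGrad q x f) = 0 := by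
  rw [siteGrad_apply, map_sub, resample_of_substAt q fun b => substAt_resample q x b f, sub_self]

theorem substAt_comm {x y : Site d} (h : x ≠ y) (b b' : Bool) (f : localFun d) :
    substAt x b (substAt y b' f) = substAt y b' (substAt x b f) := by
  ext η; simp [Function.update_comm h]

theorem siteGrad_comm (q : I) (x y : Site d) (f : localFun d) :
    siteGrad q x (siteGrad q y f) = siteGrad q y (siteGrad q x f) := by
  rcases eq_or_ne x y with rfl | h
  · rfl
  simp only [siteGrad_apply, resample_apply, map_sub, map_add, map_smul, substAt_comm h.symm]
  module

theorem mean_siteGrad_mul_siteGrad (q : I) (x : Site d) (f g : localFun d) :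
    mean q (siteGrad q x f * siteGrad q x g) = mean q (siteGrad q x f * g) := by
  have h : mean q (resample q x g * siteGrad q x f) = 0 := by
    rw [← mean_resample q x, resample_mul_left q fun b => substAt_resample q x b g,
      resample_siteGrad, mul_zero, map_zero]
  rw [siteGrad_apply q x g, mul_sub, map_sub, mul_comm _ (resample q x g), h, sub_zero]

/-- The indicator function `1 - η_x` of the event that the site `x` is empty. -/
def vacant (x : Site d) : localFun d :=
  ⟨fun η => 1 - occ η x, {x}, fun η η' h => by simp [occ, h x (by simp)]⟩

theorem vacant_nonneg (x : Site d) (η : Config d) : 0 ≤ vacant x η := (occ_mem η x).1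

theorem vacant_le_one (x : Site d) (η : Config d) : vacant x η ≤ 1 := (occ_mem η x).2

theorem substAt_vacant_of_ne {x y : Site d} (h : y ≠ x) (b : Bool) :
    substAt x b (vacant y) = vacant y := by
  ext η; simp [vacant, occ, Function.update_of_ne h]

theorem translation_vacant (z x : Site d) : translation z (vacant x) = vacant (z + x) := rfl

theorem mean_mul_vacant (q : I) {x : Site d} {k : localFun d} (hk : ∀ b, substAt x b k = k) :
    mean q (k * vacant x) = q * mean q k := by
  have h : resample q x (vacant x) = (q : ℝ) • (1 : localFun d) := by
    ext η; simp [resample_apply, vacant, occ]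
  rw [← mean_resample q x, resample_mul_left q hk, h, mul_smul_comm, mul_one, map_smul,
    smul_eq_mul]

/-- The algebra of functions of the occupation variables in `B`. -/
def supportedOn (B : Finset (Site d)) : Subalgebra ℝ (localFun d) where
  carrier := {f | DependsOn f (B : Set (Site d))}
  mul_mem' hf hg _ _ h := congrArg₂ (· * ·) (hf h) (hg h)
  add_mem' hf hg _ _ h := congrArg₂ (· + ·) (hf h) (hg h)
  algebraMap_mem' _ _ _ _ := rfl

theorem exists_mem_supportedOn (f : localFun d) : ∃ B, f ∈ supportedOn B := f.2

theorem supportedOn_mono {A B : Finset (Site d)} (h : A ⊆ B) :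
    supportedOn (d := d) A ≤ supportedOn B :=
  fun _ hf => DependsOn.mono (Finset.coe_subset.2 h) hf

theorem exists_mem_supportedOn₂ (f g : localFun d) :
    ∃ B, f ∈ supportedOn B ∧ g ∈ supportedOn B := by
  classical
  obtain ⟨A, hA⟩ := exists_mem_supportedOn f
  obtain ⟨B, hB⟩ := exists_mem_supportedOn g
  exact ⟨A ∪ B, supportedOn_mono Finset.subset_union_left hA,
    supportedOn_mono Finset.subset_union_right hB⟩

theorem substAt_of_notMem {B : Finset (Site d)} {x : Site d} (hx : x ∉ B) {f : localFun d}
    (hf : f ∈ supportedOn B) (b : Bool) : substAt x b f = f :=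
  Subtype.ext <| funext fun _ => hf fun _ ha =>
    Function.update_of_ne (ne_of_mem_of_not_mem ha hx) _ _

theorem siteGrad_of_notMem (q : I) {B : Finset (Site d)} {x : Site d} (hx : x ∉ B)
    {f : localFun d} (hf : f ∈ supportedOn B) : siteGrad q x f = 0 :=
  siteGrad_of_substAt q (substAt_of_notMem hx hf)

theorem substAt_mem_supportedOn (x : Site d) (b : Bool) {B : Finset (Site d)} {f : localFun d}
    (hf : f ∈ supportedOn B) : substAt x b f ∈ supportedOn B := fun _ _ h =>
  hf fun y hy => dependsOn_update x b y fun _ hz => h _ (hz ▸ hy)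

theorem siteGrad_mem_supportedOn (q : I) (x : Site d) {B : Finset (Site d)} {f : localFun d}
    (hf : f ∈ supportedOn B) : siteGrad q x f ∈ supportedOn B :=
  sub_mem hf (add_mem ((supportedOn B).smul_mem (substAt_mem_supportedOn x _ hf) _)
    ((supportedOn B).smul_mem (substAt_mem_supportedOn x _ hf) _))

end localFun

open localFun

/-! ## The generator of the environment on local functions -/

namespace KCSM

variable (K : KCSM d) (q : I)

/-- A finite neighbourhood of the origin that determines the constraints. -/
def nbhd : Finset (Site d) := K.finite_range.choose

theorem c_congr (x : Site d) (η η' : Config d) (h : ∀ a ∈ K.nbhd, η (x + a) = η' (x + a)) :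
    K.c x η = K.c x η' :=
  K.finite_range.choose_spec x η η' h

theorem dependsOn_ite_c (y : Site d) {B : Set (Site d)} (h : ∀ a ∈ K.nbhd, y + a ∈ B) :
    DependsOn (fun η => if K.c y η then (1 : ℝ) else 0) B := fun η η' hη => by
  simp only [K.c_congr y η η' fun a ha => hη _ (h a ha)]

/-- The indicator function of the event that the constraint at `y` is satisfied. -/
def ind (y : Site d) : localFun d :=
  ⟨fun η => if K.c y η then 1 else 0, K.nbhd.map (addLeftEmbedding y),
    K.dependsOn_ite_c y fun a ha => by simpa using ha⟩

theorem ind_apply (y : Site d) (η : Config d) : K.ind y η = if K.c y η then 1 else 0 := rfl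

theorem ind_nonneg (y : Site d) (η : Config d) : 0 ≤ K.ind y η := by
  rw [ind_apply]; split_ifs <;> norm_num

theorem ind_le_one (y : Site d) (η : Config d) : K.ind y η ≤ 1 := by
  rw [ind_apply]; split_ifs <;> norm_num

theorem ind_mem_supportedOn {y : Site d} {B : Finset (Site d)} (h : ∀ a ∈ K.nbhd, y + a ∈ B) :
    K.ind y ∈ supportedOn B :=
  K.dependsOn_ite_c y h

theorem substAt_ind_self (y : Site d) (b : Bool) : substAt y b (K.ind y) = K.ind y := by
  ext η
  have h : K.c y (Function.update η y b) = K.c y η := by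
    by_cases hb : b = η y
    · rw [hb, Function.update_eq_self]
    · rw [Bool.eq_not_of_ne hb]
      exact K.c_flip y η
  simp only [substAt_apply, ind_apply, h]

theorem substAt_ind_of_forall_ne {x y : Site d} (h : ∀ a ∈ K.nbhd, y + a ≠ x) (b : Bool) :
    substAt x b (K.ind y) = K.ind y :=
  substAt_of_notMem (B := K.nbhd.map (addLeftEmbedding y)) (by simpa using h)
    (K.ind_mem_supportedOn fun a ha => by simpa using ha) b

/-- The operator `c_y (1 - μ_y)`, minus which is the part of the generator at the site `y`; here
`μ_y` is the conditional expectation given all coordinates except the one at `y`. -/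
def siteOp (y : Site d) : localFun d →ₗ[ℝ] localFun d :=
  LinearMap.mulLeft ℝ (K.ind y) ∘ₗ siteGrad q y

theorem siteOp_apply (y : Site d) (f : localFun d) :
    K.siteOp q y f = K.ind y * siteGrad q y f := rfl

theorem siteOp_mem_supportedOn {y : Site d} {B : Finset (Site d)} (h : ∀ a ∈ K.nbhd, y + a ∈ B)
    {f : localFun d} (hf : f ∈ supportedOn B) : K.siteOp q y f ∈ supportedOn B :=
  mul_mem (K.ind_mem_supportedOn h) (siteGrad_mem_supportedOn q y hf)

theorem rate_mul_flipAt_sub (y : Site d) (f : localFun d) (η : Config d) :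
    K.rate q y η * (f (flipAt y η) - f η) = -K.siteOp q y f η := by
  cases hy : η y
  all_goals
    have hη := Function.update_eq_self y η
    rw [hy] at hη
    simp only [siteOp_apply, siteGrad_apply, resample_apply, rate, flipAt, occ, hy, ind_apply,
      MulMemClass.coe_mul, AddSubgroupClass.coe_sub, AddMemClass.coe_add, SetLike.val_smul,
      Pi.mul_apply, Pi.sub_apply, Pi.add_apply, Pi.smul_apply, substAt_apply, hη, smul_eq_mul,
      Bool.not_false, Bool.not_true, Bool.false_eq_true, if_true, if_false]
    ring

theorem envOp_coe {B : Finset (Site d)} {f : localFun d} (hf : f ∈ supportedOn B) :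
    K.envOp q f = (-∑ y ∈ B, K.siteOp q y f : localFun d) := by
  funext η
  simp only [envOp, rate_mul_flipAt_sub]
  rw [tsum_eq_sum (s := B)]
  · simp
  · intro y hy
    rw [siteOp_apply, siteGrad_of_notMem q hy hf, mul_zero]; simp

/-- The generator of the environment on local functions. -/
def envLin : localFun d →ₗ[ℝ] localFun d where
  toFun f := ⟨K.envOp q f, by
    obtain ⟨B, hB⟩ := exists_mem_supportedOn f
    rw [K.envOp_coe q hB]
    exact Subtype.property _⟩
  map_add' f g := by
    obtain ⟨B, hf, hg⟩ := exists_mem_supportedOn₂ f g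
    ext1
    simp only [AddMemClass.coe_add]
    rw [← AddMemClass.coe_add, K.envOp_coe q hf, K.envOp_coe q hg, K.envOp_coe q (add_mem hf hg),
      ← AddMemClass.coe_add]
    simp only [map_add, Finset.sum_add_distrib, neg_add]
  map_smul' c f := by
    ext η
    simp only [envOp, SetLike.val_smul, Pi.smul_apply, smul_eq_mul, ← mul_sub, ← tsum_mul_left,
      mul_left_comm, RingHom.id_apply]

@[simp] theorem coe_envLin (f : localFun d) : (K.envLin q f : Config d → ℝ) = K.envOp q f := rfl

theorem envLin_eq {B : Finset (Site d)} {f : localFun d} (hf : f ∈ supportedOn B) :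
    K.envLin q f = -∑ y ∈ B, K.siteOp q y f :=
  Subtype.ext (K.envOp_coe q hf)

theorem mean_siteOp_mul (y : Site d) (f g : localFun d) :
    mean q (K.siteOp q y f * g) = mean q (K.ind y * (siteGrad q y f * siteGrad q y g)) := by
  rw [siteOp_apply, ← siteGrad_mul_left q (K.substAt_ind_self y), ← mean_siteGrad_mul_siteGrad,
    siteGrad_mul_left q (K.substAt_ind_self y), mul_assoc]

theorem mean_envLin_mul {B : Finset (Site d)} {f : localFun d} (hf : f ∈ supportedOn B)
    (g : localFun d) : mean q (K.envLin q f * g) =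
      -∑ y ∈ B, mean q (K.ind y * (siteGrad q y f * siteGrad q y g)) := by
  rw [K.envLin_eq q hf, neg_mul (α := localFun d), Finset.sum_mul, map_neg, map_sum]
  simp only [mean_siteOp_mul]

theorem mean_envLin_mul_comm (f g : localFun d) :
    mean q (K.envLin q f * g) = mean q (K.envLin q g * f) := by
  obtain ⟨B, hf, hg⟩ := exists_mem_supportedOn₂ f g
  rw [K.mean_envLin_mul q hf, K.mean_envLin_mul q hg]
  simp only [mul_comm (siteGrad q _ f)]

theorem mean_envLin_mul_self_nonpos (f : localFun d) : mean q (K.envLin q f * f) ≤ 0 := by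
  obtain ⟨B, hf⟩ := exists_mem_supportedOn f
  rw [K.mean_envLin_mul q hf]
  exact neg_nonpos.2 <| Finset.sum_nonneg fun y _ => mean_nonneg q fun η =>
    mul_nonneg (K.ind_nonneg y η) (mul_self_nonneg (siteGrad q y f η))

end KCSM

/-! ## The jumps of the tracer -/

/-- The rate of the jump by `z`. -/
def jumpRate (z : Site d) : localFun d := vacant 0 * vacant z

theorem jumpRate_nonneg (z : Site d) (η : Config d) : 0 ≤ jumpRate z η :=
  mul_nonneg (vacant_nonneg 0 η) (vacant_nonneg z η)

theorem jumpRate_le_one (z : Site d) (η : Config d) : jumpRate z η ≤ 1 :=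
  mul_le_one₀ (vacant_le_one 0 η) (vacant_nonneg z η) (vacant_le_one z η)

theorem translation_jumpRate_neg (z : Site d) : translation z (jumpRate (-z)) = jumpRate z := by
  rw [jumpRate, map_mul, translation_vacant, translation_vacant, add_zero, add_neg_cancel, mul_comm,
    jumpRate]

theorem unitVec_ne_zero (i : Fin d) : unitVec i ≠ 0 := Pi.single_ne_zero_iff.2 one_ne_zero

theorem mean_jumpRate_unitVec (q : I) (i : Fin d) :
    mean q (jumpRate (unitVec i)) = (q : ℝ) ^ 2 := by
  rw [jumpRate, mean_mul_vacant q (substAt_vacant_of_ne (unitVec_ne_zero i).symm),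
    ← one_mul (vacant 0), mean_mul_vacant q fun b => map_one _, mean_one, mul_one, sq]

/-- The part of the generator that comes from jumps by `z`. -/
def jumpBy (z : Site d) : localFun d →ₗ[ℝ] localFun d :=
  LinearMap.mulLeft ℝ (jumpRate z) ∘ₗ ((translation z).toLinearMap - LinearMap.id)

theorem jumpBy_apply (z : Site d) (f : localFun d) :
    jumpBy z f = jumpRate z * (translation z f - f) := rfl

variable (d) in
/-- The part of the generator that comes from the jumps of the tracer, on local functions. -/
def jumpLin : localFun d →ₗ[ℝ] localFun d :=
  ∑ i, (jumpBy (unitVec i) + jumpBy (-unitVec i))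

theorem coe_jumpLin (f : localFun d) : (jumpLin d f : Config d → ℝ) = jumpOp f := by
  funext η
  simp [jumpLin, jumpOp, jumpBy_apply, jumpRate, vacant,
    Finset.sum_pair (show (1 : ℤ) ≠ -1 by norm_num)]

theorem mean_jumpRate_neg_mul (q : I) (z : Site d) (f g : localFun d) :
    mean q (jumpRate (-z) * (translation (-z) f * g)) =
      mean q (jumpRate z * (f * translation z g)) := by
  have h : translation z (translation (-z) f) = f := by
    ext η
    exact congrArg f (funext fun x => congrArg η (by abel))
  rw [← mean_translation q z, map_mul (translation z), map_mul (translation z),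
    translation_jumpRate_neg, h]

/-- The Dirichlet form of the jumps along one bond. -/
def bondForm (q : I) (z : Site d) (f g : localFun d) : ℝ :=
  mean q (jumpRate z * ((translation z f - f) * (translation z g - g)))

theorem mean_jumpBy_add_jumpBy_neg (q : I) (z : Site d) (f g : localFun d) :
    mean q ((jumpBy z f + jumpBy (-z) f) * g) = -bondForm q z f g := by
  have hfg := mean_jumpRate_neg_mul q z f g
  have hone := mean_jumpRate_neg_mul q z 1 (f * g)
  calc mean q ((jumpBy z f + jumpBy (-z) f) * g)
      = mean q (jumpBy z f * g) + (mean q (jumpRate (-z) * (translation (-z) f * g)) -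
          mean q (jumpRate (-z) * (translation (-z) 1 * (f * g)))) := by
        rw [← map_sub, ← map_add, map_one]; congr 1; simp only [jumpBy_apply]; ring
    _ = -bondForm q z f g := by
        rw [hfg, hone, bondForm, ← map_sub, ← map_add, ← map_neg, map_mul]
        congr 1; simp only [jumpBy_apply]; ring

theorem mean_jumpLin_mul (q : I) (f g : localFun d) :
    mean q (jumpLin d f * g) = -∑ i, bondForm q (unitVec i) f g := by
  simp only [jumpLin, LinearMap.sum_apply, LinearMap.add_apply, Finset.sum_mul, map_sum,
    mean_jumpBy_add_jumpBy_neg, Finset.sum_neg_distrib]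

theorem bondForm_comm (q : I) (z : Site d) (f g : localFun d) :
    bondForm q z f g = bondForm q z g f := by
  rw [bondForm, bondForm, mul_comm (translation z f - f)]

theorem bondForm_self_nonneg (q : I) (z : Site d) (f : localFun d) : 0 ≤ bondForm q z f f :=
  mean_nonneg q fun η => mul_nonneg (jumpRate_nonneg z η) (mul_self_nonneg _)

theorem bondForm_self_le (q : I) (z : Site d) (f : localFun d) (m : ℝ) :
    bondForm q z f f ≤ 4 * mean q ((f - algebraMap ℝ _ m) ^ 2) := by
  set g := f - algebraMap ℝ _ m with hg
  have hfg : translation z f - f = translation z g - g := by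
    rw [hg, map_sub, AlgHom.commutes]; ring
  calc bondForm q z f f ≤ mean q ((2 : ℝ) • translation z (g ^ 2) + (2 : ℝ) • g ^ 2) := by
        rw [bondForm, hfg]
        refine mean_mono q fun η => ?_
        change jumpRate z η * ((g (shift z η) - g η) * (g (shift z η) - g η)) ≤
          2 * g (shift z η) ^ 2 + 2 * g η ^ 2
        nlinarith [jumpRate_nonneg z η, jumpRate_le_one z η, sq_nonneg (g (shift z η) - g η),
          sq_nonneg (g (shift z η) + g η)]
    _ = 4 * mean q (g ^ 2) := by
        rw [map_add, map_smul, map_smul, mean_translation, smul_eq_mul]; ring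

/-! ## The current -/

/-- The current `j_u` as a local function. -/
def currentFun (u : Fin d → ℝ) : localFun d :=
  ∑ i, u i • (jumpRate (unitVec i) - jumpRate (-unitVec i))

theorem coe_currentFun (u : Fin d → ℝ) : (currentFun u : Config d → ℝ) = current u := by
  funext η
  simp only [current, Finset.mul_sum, Finset.sum_pair (show (1 : ℤ) ≠ -1 by norm_num)]
  simp only [currentFun, jumpRate, vacant, AddSubmonoidClass.coe_finsetSum, SetLike.val_smul,
    AddSubgroupClass.coe_sub, MulMemClass.coe_mul, Finset.sum_apply, Pi.smul_apply, Pi.sub_apply,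
    Pi.mul_apply, smul_eq_mul, one_smul, neg_smul, Int.cast_one, Int.cast_neg]
  refine Finset.sum_congr rfl fun i _ => ?_
  ring

theorem mean_jumpRate_sub_mul (q : I) (z : Site d) (f : localFun d) :
    mean q ((jumpRate z - jumpRate (-z)) * f) = -mean q (jumpRate z * (translation z f - f)) := by
  have h := mean_jumpRate_neg_mul q z 1 f
  rw [map_one, one_mul, one_mul] at h
  rw [sub_mul, map_sub, h, mul_sub, map_sub, neg_sub]

theorem sq_mean_mul_le (q : I) {k : localFun d} (hk : ∀ η, 0 ≤ k η) (g : localFun d) :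
    mean q (k * g) ^ 2 ≤ mean q k * mean q (k * (g * g)) := by
  have hquad : ∀ t : ℝ,
      0 ≤ mean q (k * (g * g)) * (t * t) + 2 * mean q (k * g) * t + mean q k := by
    intro t
    have h : 0 ≤ mean q (k * (t • g + 1) ^ 2) :=
      mean_nonneg q fun η => mul_nonneg (hk η) (sq_nonneg ((t • g + 1 : localFun d) η))
    have hexp : k * (t • g + 1) ^ 2 = (t * t) • (k * (g * g)) + (2 * t) • (k * g) + k := by
      ext η; simp; ring
    rw [hexp, map_add, map_add, map_smul, map_smul, smul_eq_mul, smul_eq_mul] at h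
    linarith
  have hdisc := discrim_le_zero hquad
  rw [discrim] at hdisc
  linarith

theorem sq_mean_currentFun_mul_le (q : I) (u : Fin d → ℝ) (f : localFun d) :
    mean q (currentFun u * f) ^ 2 ≤
      ((q : ℝ) ^ 2 * ∑ i, u i ^ 2) * ∑ i, bondForm q (unitVec i) f f := by
  have hcurrent : mean q (currentFun u * f) =
      ∑ i, u i * -mean q (jumpRate (unitVec i) * (translation (unitVec i) f - f)) := by
    simp only [currentFun, Finset.sum_mul, smul_mul_assoc, map_sum, map_smul, smul_eq_mul,
      mean_jumpRate_sub_mul]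
  rw [hcurrent]
  calc _ ≤ (∑ i, u i ^ 2) *
        ∑ i, (-mean q (jumpRate (unitVec i) * (translation (unitVec i) f - f))) ^ 2 :=
        Finset.sum_mul_sq_le_sq_mul_sq _ _ _
    _ ≤ (∑ i, u i ^ 2) * ∑ i, (q : ℝ) ^ 2 * bondForm q (unitVec i) f f := by
        gcongr with i
        rw [neg_sq, ← mean_jumpRate_unitVec q i]
        exact sq_mean_mul_le q (jumpRate_nonneg _) _
    _ = _ := by rw [← Finset.mul_sum]; ring

/-! ## The generator of the environment seen from the tracer -/

namespace KCSM

variable (K : KCSM d) (q : I)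

/-- The generator of the environment seen from the tracer, on local functions. -/
def tracerLin : localFun d →ₗ[ℝ] localFun d := K.envLin q + jumpLin d

theorem coe_tracerLin (f : localFun d) :
    (K.tracerLin q f : Config d → ℝ) = K.tracerOp q f := by
  funext η
  simp [tracerLin, tracerOp, coe_jumpLin]

theorem mean_tracerLin_mul (f g : localFun d) : mean q (K.tracerLin q f * g) =
    mean q (K.envLin q f * g) - ∑ i, bondForm q (unitVec i) f g := by
  rw [tracerLin, LinearMap.add_apply, add_mul, map_add, mean_jumpLin_mul, sub_eq_add_neg]

theorem mean_tracerLin_mul_comm (f g : localFun d) :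
    mean q (K.tracerLin q f * g) = mean q (K.tracerLin q g * f) := by
  rw [mean_tracerLin_mul, mean_tracerLin_mul, mean_envLin_mul_comm]
  simp only [bondForm_comm q _ f g]

end KCSM

/-! ## Local functions in `L²(μ)` -/

/-- The class of a local function in `L²(μ)`. -/
def toL2 (q : I) : localFun d →ₗ[ℝ] L2 d q where
  toFun f := (memLp f 2 (mu d q)).toLp f
  map_add' _ _ := rfl
  map_smul' _ _ := rfl

theorem coeFn_toL2 (q : I) (f : localFun d) : toL2 q f =ᵐ[mu d q] f :=
  MemLp.coeFn_toLp (memLp f 2 (mu d q))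

theorem eq_toL2 (q : I) {f : localFun d} {p : L2 d q} (h : p =ᵐ[mu d q] f) : p = toL2 q f :=
  Lp.ext (h.trans (coeFn_toL2 q f).symm)

theorem inner_eq_integral (q : I) (f g : L2 d q) :
    inner ℝ f g = ∫ η, f η * g η ∂(mu d q) := by
  rw [L2.inner_def]
  simp [mul_comm]

theorem inner_toL2_right (q : I) (h : L2 d q) (f : localFun d) :
    inner ℝ h (toL2 q f) = ∫ η, h η * f η ∂(mu d q) := by
  rw [inner_eq_integral]
  refine integral_congr_ae ?_
  filter_upwards [coeFn_toL2 q f] with η hη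
  rw [hη]

theorem inner_toL2 (q : I) (f g : localFun d) :
    inner ℝ (toL2 q f) (toL2 q g) = mean q (f * g) := by
  rw [inner_toL2_right]
  refine integral_congr_ae ?_
  filter_upwards [coeFn_toL2 q f] with η hη
  rw [hη]; rfl

theorem norm_toL2_sq (q : I) (f : localFun d) : ‖toL2 q f‖ ^ 2 = mean q (f ^ 2) := by
  rw [← real_inner_self_eq_norm_sq, inner_toL2, sq]

theorem norm_toL2_le_of_abs_le (q : I) {f g : localFun d} (h : ∀ η, |f η| ≤ |g η|) :
    ‖toL2 q f‖ ≤ ‖toL2 q g‖ := by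
  rw [← sq_le_sq₀ (norm_nonneg _) (norm_nonneg _), norm_toL2_sq, norm_toL2_sq]
  exact mean_mono q fun η => sq_le_sq.2 (h η)

theorem norm_toL2_translation (q : I) (z : Site d) (f : localFun d) :
    ‖toL2 q (translation z f)‖ = ‖toL2 q f‖ := by
  rw [← sq_eq_sq₀ (norm_nonneg _) (norm_nonneg _), norm_toL2_sq, norm_toL2_sq, ← map_pow,
    mean_translation]

theorem setIntegral_eq_zero_of_forall_measurableCylinders {ν : Measure (Config d)}
    [IsFiniteMeasure ν] {h : Config d → ℝ} (hint : Integrable h ν)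
    (hh : ∀ s ∈ measurableCylinders fun _ : Site d => Bool, ∫ η in s, h η ∂ν = 0)
    {s : Set (Config d)} (hs : MeasurableSet s) : ∫ η in s, h η ∂ν = 0 := by
  induction s, hs using MeasurableSpace.induction_on_inter
    (generateFrom_measurableCylinders (α := fun _ : Site d => Bool)).symm
    isPiSystem_measurableCylinders with
  | empty => simp
  | basic s hs => exact hh s hs
  | compl s hs ih =>
    have huniv := hh _ (univ_mem_measurableCylinders _)
    rwa [setIntegral_univ, ← integral_add_compl hs hint, ih, zero_add] at huniv
  | iUnion f hd hm ih =>
    rw [integral_iUnion hm hd hint.integrableOn]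
    simp [ih]

theorem eq_zero_of_forall_inner_toL2 (q : I) {h : L2 d q}
    (hh : ∀ f, inner ℝ h (toL2 q f) = 0) : h = 0 := by
  have hint : Integrable h (mu d q) := (Lp.memLp h).integrable (by norm_num)
  have hcyl : ∀ s ∈ measurableCylinders fun _ : Site d => Bool,
      ∫ η in s, h η ∂(mu d q) = 0 := by
    intro s hs
    obtain ⟨A, S, hS, rfl⟩ := (mem_measurableCylinders s).1 hs
    let f : localFun d :=
      ⟨(cylinder A S).indicator fun _ => 1, A,
        dependsOn_cylinder_indicator_const (α := fun _ => Bool) S 1⟩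
    rw [← integral_indicator (hS.cylinder A), ← hh f, inner_toL2_right]
    refine integral_congr_ae (Eventually.of_forall fun η => ?_)
    by_cases hη : η ∈ cylinder A S <;> simp [f, hη]
  have hzero := hint.ae_eq_zero_of_forall_setIntegral_eq_zero fun s hs _ =>
    setIntegral_eq_zero_of_forall_measurableCylinders hint hcyl hs
  exact Lp.ext (hzero.trans (Lp.coeFn_zero ℝ 2 (mu d q)).symm)

theorem denseRange_toL2 (q : I) : DenseRange (toL2 (d := d) q) := by
  rw [DenseRange, ← LinearMap.coe_range, Submodule.dense_iff_topologicalClosure_eq_top,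
    Submodule.topologicalClosure_eq_top_iff, Submodule.eq_bot_iff]
  intro h hh
  refine eq_zero_of_forall_inner_toL2 q fun f => ?_
  rw [real_inner_comm]
  exact (Submodule.mem_orthogonal _ _).1 hh _ (LinearMap.mem_range_self _ f)

/-! ## Closures of operators on local functions -/

theorem closedGraph_eq_coreGraph (q : I) {T : (Config d → ℝ) → Config d → ℝ}
    {T' : localFun d →ₗ[ℝ] localFun d} (hT : ∀ f, (T' f : Config d → ℝ) = T f) :
    closedGraph q T = coreGraph (toL2 q) (toL2 q ∘ₗ T') := by
  rw [coreGraph, Submodule.topologicalClosure_coe, closedGraph]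
  congr 1
  ext p
  constructor
  · rintro ⟨f, hf, hfst, hsnd⟩
    exact ⟨⟨f, hf⟩, (Prod.ext (eq_toL2 q hfst) (eq_toL2 q (by rwa [hT]))).symm⟩
  · rintro ⟨f, rfl⟩
    exact ⟨f, f.2, coeFn_toL2 q f, hT f ▸ coeFn_toL2 q (T' f)⟩

namespace KCSM

variable (K : KCSM d) (q : I)

theorem envGenerator_eq : K.envGenerator q = coreGraph (toL2 q) (toL2 q ∘ₗ K.envLin q) :=
  closedGraph_eq_coreGraph q (K.coe_envLin q)

theorem tracerGenerator_eq :
    K.tracerGenerator q = coreGraph (toL2 q) (toL2 q ∘ₗ K.tracerLin q) :=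
  closedGraph_eq_coreGraph q (K.coe_tracerLin q)

theorem inner_toL2_envLin_nonpos (f : localFun d) :
    inner ℝ (toL2 q f) ((toL2 q ∘ₗ K.envLin q) f) ≤ 0 := by
  rw [LinearMap.comp_apply, real_inner_comm, inner_toL2]
  exact K.mean_envLin_mul_self_nonpos q f

theorem inner_toL2_tracerLin_nonpos (f : localFun d) :
    inner ℝ (toL2 q f) ((toL2 q ∘ₗ K.tracerLin q) f) ≤ 0 := by
  rw [LinearMap.comp_apply, real_inner_comm, inner_toL2, mean_tracerLin_mul]
  have hbond : 0 ≤ ∑ i, bondForm q (unitVec i) f f :=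
    Finset.sum_nonneg fun i _ => bondForm_self_nonneg q _ f
  linarith [K.mean_envLin_mul_self_nonpos q f]

theorem tracerGenerator_symm : ∀ p ∈ K.tracerGenerator q, ∀ p' ∈ K.tracerGenerator q,
    inner ℝ p.2 p'.1 = inner ℝ p.1 p'.2 := by
  rw [tracerGenerator_eq]
  refine inner_snd_fst_of_mem_coreGraph fun f g => ?_
  rw [LinearMap.comp_apply, LinearMap.comp_apply, real_inner_comm (toL2 q (K.tracerLin q g)),
    inner_toL2, inner_toL2]
  exact K.mean_tracerLin_mul_comm q f g

theorem dense_fst_tracerGenerator : Dense (Prod.fst '' K.tracerGenerator q) := by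
  rw [tracerGenerator_eq]
  exact dense_fst_coreGraph (denseRange_toL2 q)

end KCSM

theorem norm_toL2_jumpBy_le (q : I) (z : Site d) (f : localFun d) :
    ‖toL2 q (jumpBy z f)‖ ≤ 2 * ‖toL2 q f‖ :=
  calc ‖toL2 q (jumpBy z f)‖ ≤ ‖toL2 q (translation z f - f)‖ := by
        refine norm_toL2_le_of_abs_le q fun η => ?_
        change |jumpRate z η * (translation z f - f) η| ≤ _
        rw [abs_mul, abs_of_nonneg (jumpRate_nonneg z η)]
        exact mul_le_of_le_one_left (abs_nonneg _) (jumpRate_le_one z η)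
    _ ≤ ‖toL2 q (translation z f)‖ + ‖toL2 q f‖ := by
        rw [map_sub]; exact norm_sub_le _ _
    _ = 2 * ‖toL2 q f‖ := by rw [norm_toL2_translation]; ring

theorem norm_toL2_jumpLin_le (q : I) (f : localFun d) :
    ‖toL2 q (jumpLin d f)‖ ≤ 4 * d * ‖toL2 q f‖ := by
  simp only [jumpLin, LinearMap.sum_apply, LinearMap.add_apply, map_sum, map_add]
  calc _ ≤ ∑ _i : Fin d, (2 * ‖toL2 q f‖ + 2 * ‖toL2 q f‖) :=
        norm_sum_le_of_le _ fun i _ => norm_add_le_of_le (norm_toL2_jumpBy_le q _ f)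
          (norm_toL2_jumpBy_le q _ f)
    _ = 4 * d * ‖toL2 q f‖ := by
        rw [Finset.sum_const, Finset.card_univ, Fintype.card_fin, nsmul_eq_mul]; ring

/-! ## The spectral gap -/

theorem sum_bondForm_le (q : I) (f : localFun d) :
    ∑ i, bondForm q (unitVec i) f f ≤ 4 * d * ProbabilityTheory.variance f (mu d q) := by
  rw [ProbabilityTheory.variance_eq_integral (measurable f).aemeasurable]
  calc _ ≤ ∑ _i : Fin d, 4 * mean q ((f - algebraMap ℝ _ (mean q f)) ^ 2) :=
        Finset.sum_le_sum fun i _ => bondForm_self_le q _ f _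
    _ = 4 * d * mean q ((f - algebraMap ℝ _ (mean q f)) ^ 2) := by
        rw [Finset.sum_const, Finset.card_univ, Fintype.card_fin, nsmul_eq_mul]; ring

namespace KCSM

variable (K : KCSM d) (q : I)

theorem zero_mem_lowerBounds_gap : 0 ∈ lowerBounds {r | ∃ f g : L2 d q,
    (f, g) ∈ K.envGenerator q ∧ ProbabilityTheory.variance f (mu d q) ≠ 0 ∧
      r = -(∫ η, f η * g η ∂(mu d q)) / ProbabilityTheory.variance f (mu d q)} := by
  rintro _ ⟨f, g, hfg, -, rfl⟩
  rw [envGenerator_eq] at hfg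
  rw [← inner_eq_integral]
  exact div_nonneg
    (neg_nonneg.2 (inner_nonpos_of_mem_coreGraph (K.inner_toL2_envLin_nonpos q) _ hfg))
    (ProbabilityTheory.variance_nonneg _ _)

theorem gap_nonneg : 0 ≤ K.gap q := Real.sInf_nonneg (K.zero_mem_lowerBounds_gap q)

theorem gap_mul_variance_le (f : localFun d) :
    K.gap q * ProbabilityTheory.variance f (mu d q) ≤ -mean q (K.envLin q f * f) := by
  have hv : ProbabilityTheory.variance (toL2 q f) (mu d q) =
      ProbabilityTheory.variance f (mu d q) :=
    ProbabilityTheory.variance_congr (coeFn_toL2 q f)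
  rcases (ProbabilityTheory.variance_nonneg f (mu d q)).eq_or_lt with h0 | hpos
  · rw [← h0, mul_zero]
    exact neg_nonneg.2 (K.mean_envLin_mul_self_nonpos q f)
  rw [← le_div_iff₀ hpos]
  refine csInf_le ⟨0, K.zero_mem_lowerBounds_gap q⟩
    ⟨toL2 q f, toL2 q (K.envLin q f), ?_, hv ▸ hpos.ne', ?_⟩
  · rw [envGenerator_eq]
    exact mem_coreGraph f
  · rw [hv, ← inner_eq_integral, inner_toL2, mul_comm f]

theorem gap_mul_sum_bondForm_le (f : localFun d) :
    K.gap q * ∑ i, bondForm q (unitVec i) f f ≤ 4 * d * -mean q (K.envLin q f * f) :=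
  calc _ ≤ K.gap q * (4 * d * ProbabilityTheory.variance f (mu d q)) :=
        mul_le_mul_of_nonneg_left (sum_bondForm_le q f) (K.gap_nonneg q)
    _ = 4 * d * (K.gap q * ProbabilityTheory.variance f (mu d q)) := by ring
    _ ≤ _ := by gcongr; exact K.gap_mul_variance_le q f

theorem sum_bondForm_le_mul (f : localFun d) : ∑ i, bondForm q (unitVec i) f f ≤
    4 * d / (4 * d + K.gap q) * -mean q (K.tracerLin q f * f) := by
  have hgap := K.gap_nonneg q
  have hd : (0 : ℝ) ≤ 4 * d := by positivity
  have hbond := K.gap_mul_sum_bondForm_le q f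
  rw [mean_tracerLin_mul]
  set E := ∑ i, bondForm q (unitVec i) f f
  rcases (add_nonneg hd hgap).eq_or_lt with h0 | hpos
  · have hzero : (4 * d : ℝ) = 0 := by linarith
    have hle := sum_bondForm_le q f
    rw [hzero, zero_mul] at hle
    rwa [hzero, zero_div, zero_mul]
  · rw [div_mul_eq_mul_div, le_div_iff₀ hpos]
    linarith

theorem sq_inner_currentFun_le (u : Fin d → ℝ) :
    ∀ p ∈ K.tracerGenerator q, inner ℝ (toL2 q (currentFun u)) p.1 ^ 2 ≤
      4 * d / (4 * d + K.gap q) * ((q : ℝ) ^ 2 * ∑ i, u i ^ 2) * -inner ℝ p.1 p.2 := by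
  rw [tracerGenerator_eq]
  refine coreGraph_induction (isClosed_le (by fun_prop) (by fun_prop)) fun f => ?_
  rw [LinearMap.comp_apply, real_inner_comm (toL2 q (K.tracerLin q f)), inner_toL2, inner_toL2]
  calc _ ≤ ((q : ℝ) ^ 2 * ∑ i, u i ^ 2) * ∑ i, bondForm q (unitVec i) f f :=
        sq_mean_currentFun_mul_le q u f
    _ ≤ ((q : ℝ) ^ 2 * ∑ i, u i ^ 2) *
        (4 * d / (4 * d + K.gap q) * -mean q (K.tracerLin q f * f)) :=
        mul_le_mul_of_nonneg_left (K.sum_bondForm_le_mul q f) (by positivity)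
    _ = _ := by ring

end KCSM

/-! ## The finite-volume resolvent equation -/

theorem exists_mem_apply_eq_of_injective {𝕜 V : Type*} [DivisionRing 𝕜] [AddCommGroup V]
    [Module 𝕜 V] {W : Submodule 𝕜 V} [FiniteDimensional 𝕜 W] {T : V →ₗ[𝕜] V}
    (hinj : Function.Injective T) (hT : ∀ v ∈ W, T v ∈ W) {w : V} (hw : w ∈ W) :
    ∃ v ∈ W, T v = w := by
  have hsurj : Function.Surjective (T.restrict hT) :=
    LinearMap.injective_iff_surjective.1 fun v v' h =>
      Subtype.ext (hinj (congrArg Subtype.val h))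
  obtain ⟨v, hv⟩ := hsurj ⟨w, hw⟩
  exact ⟨v, v.2, congrArg Subtype.val hv⟩

theorem finiteDimensional_supportedOn (B : Finset (Site d)) :
    FiniteDimensional ℝ (supportedOn B) := by
  classical
  let extend : (B → Bool) → Config d := fun ξ x => if h : x ∈ B then ξ ⟨x, h⟩ else false
  let R : supportedOn B →ₗ[ℝ] (B → Bool) → ℝ :=
    { toFun := fun f ξ => f.1 (extend ξ)
      map_add' := fun _ _ => rfl
      map_smul' := fun _ _ => rfl }
  refine Module.Finite.of_injective R fun f f' h => ?_
  ext η
  have hη : ∀ x ∈ (B : Set (Site d)), η x = extend (fun b => η b) x := fun x hx => by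
    simp only [extend, dif_pos (Finset.mem_coe.1 hx)]
  exact (f.2 hη).trans ((congrFun h fun b => η b).trans (f'.2 hη).symm)

namespace KCSM

variable (K : KCSM d) (q : I) {S B : Finset (Site d)} {l : ℝ}

/-- The operator `l - L_S`, where `L_S` is the part of the generator of the environment that
updates the sites in the finite volume `S`. -/
def volumeOp (S : Finset (Site d)) (l : ℝ) : localFun d →ₗ[ℝ] localFun d :=
  l • LinearMap.id + ∑ y ∈ S, K.siteOp q y

theorem volumeOp_apply (S : Finset (Site d)) (l : ℝ) (f : localFun d) :
    K.volumeOp q S l f = l • f + ∑ y ∈ S, K.siteOp q y f := by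
  simp [volumeOp]

theorem nonpos_of_volumeOp_eq_zero (hl : 0 < l) {f : localFun d} (h : K.volumeOp q S l f = 0)
    (η : Config d) : f η ≤ 0 := by
  -- Maximum principle: `-L_S f` is nonnegative at a maximum `ζ` of `f`.
  obtain ⟨_, ⟨ζ, rfl⟩, hζ⟩ := Set.exists_max_image (Set.range f) id (localFun.finite_range f)
    (Set.range_nonempty f)
  have hmax : ∀ η, f η ≤ f ζ := fun η => hζ _ ⟨η, rfl⟩
  have hgrad : ∀ y, 0 ≤ siteGrad q y f ζ := fun y => by
    have hfalse := mul_le_mul_of_nonneg_left (hmax (Function.update ζ y false)) q.2.1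
    have htrue := mul_le_mul_of_nonneg_left (hmax (Function.update ζ y true))
      (sub_nonneg.2 q.2.2)
    change 0 ≤ f ζ - (q * f (Function.update ζ y false) + (1 - q) * f (Function.update ζ y true))
    linarith
  have hsum : 0 ≤ ∑ y ∈ S, K.ind y ζ * siteGrad q y f ζ :=
    Finset.sum_nonneg fun y _ => mul_nonneg (K.ind_nonneg y ζ) (hgrad y)
  have hζ0 : l * f ζ + ∑ y ∈ S, K.ind y ζ * siteGrad q y f ζ = 0 := by
    have := congrArg (fun f : localFun d => f ζ) h
    simpa [volumeOp_apply, siteOp_apply] using this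
  exact (hmax η).trans (nonpos_of_mul_nonpos_right (by linarith) hl)

theorem volumeOp_injective (hl : 0 < l) : Function.Injective (K.volumeOp q S l) := by
  refine (injective_iff_map_eq_zero _).2 fun f hf => ?_
  ext η
  refine le_antisymm (K.nonpos_of_volumeOp_eq_zero q hl hf η) (neg_nonpos.1 ?_)
  exact K.nonpos_of_volumeOp_eq_zero q hl (f := -f) (by rw [map_neg, hf, neg_zero]) η

theorem volumeOp_mem_supportedOn (hB : ∀ y ∈ S, ∀ a ∈ K.nbhd, y + a ∈ B) {f : localFun d}
    (hf : f ∈ supportedOn B) : K.volumeOp q S l f ∈ supportedOn B := by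
  rw [volumeOp_apply]
  exact add_mem ((supportedOn B).smul_mem hf l)
    (sum_mem fun y hy => K.siteOp_mem_supportedOn q (hB y hy) hf)

theorem exists_volumeOp_eq (hl : 0 < l) (hB : ∀ y ∈ S, ∀ a ∈ K.nbhd, y + a ∈ B) {g : localFun d}
    (hg : g ∈ supportedOn B) : ∃ f ∈ supportedOn B, K.volumeOp q S l f = g := by
  have hfin : FiniteDimensional ℝ (supportedOn B).toSubmodule := finiteDimensional_supportedOn B
  exact exists_mem_apply_eq_of_injective (W := (supportedOn B).toSubmodule)
    (K.volumeOp_injective q hl) (fun f hf => K.volumeOp_mem_supportedOn q hB hf) hg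

end KCSM

/-! ## Decay of the resolvent -/

/-- The `L²(μ)` norm of the dependence of `f` on the occupation variable at `x`. -/
def influence (q : I) (x : Site d) (f : localFun d) : ℝ := ‖toL2 q (siteGrad q x f)‖

theorem influence_nonneg (q : I) (x : Site d) (f : localFun d) : 0 ≤ influence q x f :=
  norm_nonneg _

theorem influence_of_notMem (q : I) {B : Finset (Site d)} {x : Site d} (hx : x ∉ B)
    {f : localFun d} (hf : f ∈ supportedOn B) : influence q x f = 0 := by
  rw [influence, siteGrad_of_notMem q hx hf, map_zero, norm_zero]

/-- A bound for the factor by which a jump into the finite set `N` of increments changes the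
weight `1 + ‖x‖`, summed over the jumps. -/
def growth {E : Type*} [SeminormedAddCommGroup E] (N : Finset E) : ℝ := ∑ a ∈ N, (1 + ‖a‖)

theorem growth_nonneg {E : Type*} [SeminormedAddCommGroup E] (N : Finset E) : 0 ≤ growth N :=
  Finset.sum_nonneg fun a _ => by positivity

theorem sum_one_add_norm_le {E : Type*} [SeminormedAddCommGroup E] [DecidableEq E]
    (N B : Finset E) (y : E) :
    ∑ x ∈ B with x - y ∈ N, (1 + ‖x‖) ≤ growth N * (1 + ‖y‖) :=
  calc ∑ x ∈ B with x - y ∈ N, (1 + ‖x‖) ≤ ∑ x ∈ N.map (addLeftEmbedding y), (1 + ‖x‖) := by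
        refine Finset.sum_le_sum_of_subset_of_nonneg (fun x hx => ?_) fun x _ _ => by positivity
        exact Finset.mem_map.2 ⟨x - y, (Finset.mem_filter.1 hx).2, add_sub_cancel y x⟩
    _ ≤ ∑ a ∈ N, (1 + ‖a‖) * (1 + ‖y‖) := by
        rw [Finset.sum_map]
        refine Finset.sum_le_sum fun a _ => ?_
        have hle : ‖y + a‖ ≤ ‖y‖ + ‖a‖ := norm_add_le y a
        have hmul : 0 ≤ ‖a‖ * ‖y‖ := by positivity
        rw [addLeftEmbedding_apply]
        linarith
    _ = growth N * (1 + ‖y‖) := by rw [growth, Finset.sum_mul]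

theorem sum_one_add_norm_mul_sum_le {E : Type*} [SeminormedAddCommGroup E] [DecidableEq E]
    (N : Finset E) {S B : Finset E} (hSB : S ⊆ B) {φ : E → ℝ} (hφ : ∀ y, 0 ≤ φ y) :
    ∑ x ∈ B, (1 + ‖x‖) * ∑ y ∈ S with x - y ∈ N, φ y ≤
      growth N * ∑ y ∈ B, (1 + ‖y‖) * φ y :=
  calc _ = ∑ y ∈ S, (∑ x ∈ B with x - y ∈ N, (1 + ‖x‖)) * φ y := by
        simp only [Finset.mul_sum, Finset.sum_mul, Finset.sum_filter, mul_ite, ite_mul, mul_zero,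
          zero_mul]
        exact Finset.sum_comm
    _ ≤ ∑ y ∈ S, growth N * (1 + ‖y‖) * φ y :=
        Finset.sum_le_sum fun y _ =>
          mul_le_mul_of_nonneg_right (sum_one_add_norm_le N B y) (hφ y)
    _ ≤ ∑ y ∈ B, growth N * (1 + ‖y‖) * φ y :=
        Finset.sum_le_sum_of_subset_of_nonneg hSB fun y _ _ =>
          mul_nonneg (mul_nonneg (growth_nonneg N) (by positivity)) (hφ y)
    _ = _ := by simp only [Finset.mul_sum, mul_assoc]

namespace KCSM

variable (K : KCSM d) (q : I) {S B : Finset (Site d)} {l : ℝ}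

theorem norm_toL2_siteOp_le (y : Site d) (f : localFun d) :
    ‖toL2 q (K.siteOp q y f)‖ ≤ influence q y f := by
  refine norm_toL2_le_of_abs_le q fun η => ?_
  change |K.ind y η * siteGrad q y f η| ≤ _
  rw [abs_mul, abs_of_nonneg (K.ind_nonneg y η)]
  exact mul_le_of_le_one_left (abs_nonneg _) (K.ind_le_one y η)

theorem neg_influence_mul_influence_le (x y : Site d) (f : localFun d) :
    -(influence q x f * influence q y f) ≤
      mean q (siteGrad q x f * siteGrad q x (K.siteOp q y f)) := by
  rw [mean_siteGrad_mul_siteGrad, ← inner_toL2]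
  refine le_trans (neg_le_neg ?_) (neg_le_of_abs_le (abs_real_inner_le_norm _ _))
  exact mul_le_mul_of_nonneg_left (K.norm_toL2_siteOp_le q y f) (norm_nonneg _)

theorem siteGrad_siteOp {x y : Site d} (h : x - y ∉ K.nbhd) (f : localFun d) :
    siteGrad q x (K.siteOp q y f) = K.siteOp q y (siteGrad q x f) := by
  have hne : ∀ a ∈ K.nbhd, y + a ≠ x := fun a ha he => h (by rwa [← he, add_sub_cancel_left])
  rw [siteOp_apply, siteOp_apply, siteGrad_mul_left q (K.substAt_ind_of_forall_ne hne),
    siteGrad_comm]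

theorem mean_siteGrad_mul_siteGrad_siteOp_nonneg {x y : Site d} (h : x - y ∉ K.nbhd)
    (f : localFun d) : 0 ≤ mean q (siteGrad q x f * siteGrad q x (K.siteOp q y f)) := by
  rw [K.siteGrad_siteOp q h, mul_comm, mean_siteOp_mul]
  exact mean_nonneg q fun η => mul_nonneg (K.ind_nonneg y η) (mul_self_nonneg _)

theorem mean_siteGrad_mul_siteGrad_volumeOp (x : Site d) (f : localFun d) :
    mean q (siteGrad q x f * siteGrad q x (K.volumeOp q S l f)) = l * influence q x f ^ 2 +
      ∑ y ∈ S, mean q (siteGrad q x f * siteGrad q x (K.siteOp q y f)) := by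
  rw [volumeOp_apply, map_add, map_smul, map_sum, mul_add, mul_smul_comm, Finset.mul_sum, map_add,
    map_smul, map_sum, influence, norm_toL2_sq, sq, smul_eq_mul]

theorem mul_influence_le (S : Finset (Site d)) (l : ℝ) (f : localFun d) (x : Site d) :
    l * influence q x f ≤
      influence q x (K.volumeOp q S l f) + ∑ y ∈ S with x - y ∈ K.nbhd, influence q y f := by
  set N := influence q x f with hN
  set r := ∑ y ∈ S with x - y ∈ K.nbhd, influence q y f
  have hsum : -(N * r) ≤ ∑ y ∈ S, mean q (siteGrad q x f * siteGrad q x (K.siteOp q y f)) := by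
    rw [Finset.mul_sum, ← Finset.sum_neg_distrib, Finset.sum_filter]
    refine Finset.sum_le_sum fun y _ => ?_
    split_ifs with hy
    · exact K.neg_influence_mul_influence_le q x y f
    · exact K.mean_siteGrad_mul_siteGrad_siteOp_nonneg q hy f
  have hcs : mean q (siteGrad q x f * siteGrad q x (K.volumeOp q S l f)) ≤
      N * influence q x (K.volumeOp q S l f) := by
    rw [← inner_toL2]
    exact real_inner_le_norm _ _
  rw [mean_siteGrad_mul_siteGrad_volumeOp] at hcs
  rcases (influence_nonneg q x f).eq_or_lt with h0 | hpos
  · rw [hN, ← h0, mul_zero]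
    exact add_nonneg (influence_nonneg q x _)
      (Finset.sum_nonneg fun y _ => influence_nonneg q y f)
  · exact le_of_mul_le_mul_left (by linarith) hpos

theorem sum_one_add_norm_mul_influence_le (hSB : S ⊆ B) (hl : growth K.nbhd + 1 ≤ l)
    (f : localFun d) : ∑ x ∈ B, (1 + ‖x‖) * influence q x f ≤
      ∑ x ∈ B, (1 + ‖x‖) * influence q x (K.volumeOp q S l f) := by
  set W := ∑ x ∈ B, (1 + ‖x‖) * influence q x f
  have hW : 0 ≤ W :=
    Finset.sum_nonneg fun x _ => mul_nonneg (by positivity) (influence_nonneg q x f)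
  have hle : l * W ≤ ∑ x ∈ B, (1 + ‖x‖) * influence q x (K.volumeOp q S l f) +
      ∑ x ∈ B, (1 + ‖x‖) * ∑ y ∈ S with x - y ∈ K.nbhd, influence q y f := by
    rw [Finset.mul_sum, ← Finset.sum_add_distrib]
    refine Finset.sum_le_sum fun x _ => ?_
    rw [← mul_add, mul_left_comm]
    exact mul_le_mul_of_nonneg_left (K.mul_influence_le q S l f x) (by positivity)
  have hgrowth := sum_one_add_norm_mul_sum_le K.nbhd hSB fun y => influence_nonneg q y f
  have hlW := mul_le_mul_of_nonneg_right hl hW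
  linarith

theorem norm_toL2_volumeOp_sub_le (hSB : S ⊆ B) {f : localFun d} (hf : f ∈ supportedOn B) :
    ‖toL2 q (K.volumeOp q S l f - (l • f - K.envLin q f))‖ ≤ ∑ y ∈ B \ S, influence q y f := by
  have h : K.volumeOp q S l f - (l • f - K.envLin q f) = -∑ y ∈ B \ S, K.siteOp q y f := by
    rw [K.envLin_eq q hf, volumeOp_apply, ← Finset.sum_sdiff hSB]
    abel
  rw [h, map_neg, norm_neg, map_sum]
  exact norm_sum_le_of_le _ fun y _ => K.norm_toL2_siteOp_le q y f

end KCSM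

theorem mul_sum_influence_le (q : I) {A B : Finset (Site d)} (hAB : A ⊆ B) {n : ℝ}
    (hn : ∀ y ∈ A, n ≤ ‖y‖) (f : localFun d) :
    n * ∑ y ∈ A, influence q y f ≤ ∑ y ∈ B, (1 + ‖y‖) * influence q y f :=
  calc n * ∑ y ∈ A, influence q y f ≤ ∑ y ∈ A, (1 + ‖y‖) * influence q y f := by
        rw [Finset.mul_sum]
        refine Finset.sum_le_sum fun y hy => ?_
        exact mul_le_mul_of_nonneg_right (by linarith [hn y hy]) (influence_nonneg q y f)
    _ ≤ _ := Finset.sum_le_sum_of_subset_of_nonneg hAB fun y _ _ =>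
        mul_nonneg (by positivity) (influence_nonneg q y f)

theorem sum_influence_eq_of_subset (q : I) (w : Site d → ℝ) {A B : Finset (Site d)} (hAB : A ⊆ B)
    {g : localFun d} (hg : g ∈ supportedOn A) :
    ∑ x ∈ B, w x * influence q x g = ∑ x ∈ A, w x * influence q x g :=
  (Finset.sum_subset hAB fun x _ hx => by rw [influence_of_notMem q hx hg, mul_zero]).symm

namespace KCSM

variable (K : KCSM d) (q : I) {l : ℝ}

theorem exists_mul_norm_toL2_sub_le (hl : growth K.nbhd + 1 ≤ l) {A : Finset (Site d)}
    {g : localFun d} (hg : g ∈ supportedOn A) (n : ℕ) :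
    ∃ f, n * ‖toL2 q (g - (l • f - K.envLin q f))‖ ≤
      ∑ x ∈ A, (1 + ‖x‖) * influence q x g := by
  have hl0 : 0 < l := by linarith [growth_nonneg K.nbhd]
  let S := ((isCompact_closedBall (0 : Site d) n).finite_of_discrete).toFinset
  let B := A ∪ S ∪ S.biUnion fun y => K.nbhd.image (y + ·)
  have hAB : A ⊆ B := Finset.subset_union_left.trans Finset.subset_union_left
  have hSB : S ⊆ B := Finset.subset_union_right.trans Finset.subset_union_left
  have hSN : ∀ y ∈ S, ∀ a ∈ K.nbhd, y + a ∈ B := fun y hy a ha =>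
    Finset.mem_union_right _ (Finset.mem_biUnion.2 ⟨y, hy, Finset.mem_image_of_mem _ ha⟩)
  obtain ⟨f, hf, rfl⟩ := K.exists_volumeOp_eq q hl0 hSN (supportedOn_mono hAB hg)
  have hfar : ∀ y ∈ B \ S, (n : ℝ) ≤ ‖y‖ := fun y hy => by
    have : ¬‖y‖ ≤ n := by simpa [S] using (Finset.mem_sdiff.1 hy).2
    exact (not_le.1 this).le
  refine ⟨f, ?_⟩
  calc _ ≤ n * ∑ y ∈ B \ S, influence q y f := by
        gcongr; exact K.norm_toL2_volumeOp_sub_le q hSB hf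
    _ ≤ ∑ y ∈ B, (1 + ‖y‖) * influence q y f :=
        mul_sum_influence_le q Finset.sdiff_subset hfar f
    _ ≤ _ := K.sum_one_add_norm_mul_influence_le q hSB hl f
    _ = _ := sum_influence_eq_of_subset q _ hAB hg

theorem denseRange_smul_toL2_sub_envLin (hl : growth K.nbhd + 1 ≤ l) :
    DenseRange (l • toL2 (d := d) q - toL2 q ∘ₗ K.envLin q) := by
  refine dense_closure.1 ((denseRange_toL2 q).mono ?_)
  rintro _ ⟨g, rfl⟩
  obtain ⟨A, hA⟩ := exists_mem_supportedOn g
  refine Metric.mem_closure_iff.2 fun ε hε => ?_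
  obtain ⟨n, hn⟩ := exists_nat_gt ((∑ x ∈ A, (1 + ‖x‖) * influence q x g) / ε)
  obtain ⟨f, hf⟩ := K.exists_mul_norm_toL2_sub_le q hl hA n
  refine ⟨_, ⟨f, rfl⟩, ?_⟩
  have hfg : toL2 q g - (l • toL2 (d := d) q - toL2 q ∘ₗ K.envLin q) f =
      toL2 q (g - (l • f - K.envLin q f)) := by
    simp only [LinearMap.sub_apply, LinearMap.smul_apply, LinearMap.comp_apply, map_sub, map_smul]
  rw [dist_eq_norm, hfg]
  exact lt_of_mul_lt_mul_left (hf.trans_lt ((div_lt_iff₀ hε).1 hn)) n.cast_nonneg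

/-! ## Existence of the semigroup -/

theorem exists_semigroup :
    ∃ S : ContractionSemigroup (L2 d q), S.HasGenerator (K.tracerGenerator q) := by
  rw [tracerGenerator_eq]
  refine exists_hasGenerator_coreGraph (denseRange_toL2 q) (K.inner_toL2_tracerLin_nonpos q) ?_
  have hd : (0 : ℝ) ≤ 4 * d := by positivity
  filter_upwards [eventually_ge_atTop (growth K.nbhd + 1), eventually_gt_atTop (4 * d : ℝ)]
    with l hl hdl
  rw [tracerLin, LinearMap.comp_add]
  exact denseRange_smul_sub_add (K.inner_toL2_envLin_nonpos q) (norm_toL2_jumpLin_le q)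
    (hd.trans_lt hdl) hdl (K.denseRange_smul_toL2_sub_envLin q hl)

end KCSM

/-! ## The diffusion matrix -/

theorem toL2_currentFun (q : I) (u : Fin d → ℝ) :
    toL2 q (currentFun u) = ∑ i, u i • toL2 q (currentFun (Pi.single i 1)) := by
  have hsum : currentFun u = ∑ i, u i • currentFun (Pi.single i 1) := by
    simp [currentFun, Pi.single_apply]
  rw [hsum, map_sum]
  simp only [map_smul]

namespace KCSM

variable (K : KCSM d) (q : I)

/-- The semigroup `e^{tL}` of the environment seen from the tracer. -/
def semigroup : ContractionSemigroup (L2 d q) := (K.exists_semigroup q).choose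

theorem hasGenerator : (K.semigroup q).HasGenerator (K.tracerGenerator q) :=
  (K.exists_semigroup q).choose_spec

theorem isSymmetric : (K.semigroup q).IsSymmetric :=
  (K.hasGenerator q).isSymmetric (K.dense_fst_tracerGenerator q) (K.tracerGenerator_symm q)

theorem expOp_eq (t : ℝ≥0) : expOp (K.tracerGenerator q) t = (K.semigroup q).op t := by
  rw [expOp, dif_pos (K.exists_semigroup q)]
  rfl

theorem corr_eq (u v : Fin d → ℝ) (t : ℝ≥0) : K.corr q u v t =
    inner ℝ (toL2 q (currentFun u)) ((K.semigroup q).op t (toL2 q (currentFun v))) := by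
  have hv : (memLp_current q v).toLp (current v) = toL2 q (currentFun v) :=
    eq_toL2 q (by rw [coe_currentFun]; exact MemLp.coeFn_toLp _)
  rw [corr, K.expOp_eq, hv, real_inner_comm, inner_toL2_right, coe_currentFun]
  simp only [mul_comm]

theorem corr_comm (u v : Fin d → ℝ) (t : ℝ≥0) : K.corr q u v t = K.corr q v u t := by
  rw [corr_eq, corr_eq, ← K.isSymmetric q, real_inner_comm]

theorem corr_self_nonneg (u : Fin d → ℝ) (t : ℝ≥0) : 0 ≤ K.corr q u u t :=
  K.corr_eq q u u t ▸ (K.isSymmetric q).inner_op_self_nonneg t _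

theorem corr_bound_nonneg (u : Fin d → ℝ) :
    0 ≤ 4 * d / (4 * d + K.gap q) * ((q : ℝ) ^ 2 * ∑ i, u i ^ 2) := by
  have := K.gap_nonneg q
  positivity

theorem integrableOn_corr_self (u : Fin d → ℝ) :
    IntegrableOn (fun t : ℝ => K.corr q u u t.toNNReal) (Set.Ioi 0) := by
  simp only [corr_eq]
  exact (K.isSymmetric q).integrableOn_inner_op_self (K.hasGenerator q) (K.corr_bound_nonneg q u)
    (K.sq_inner_currentFun_le q u)

theorem integrableOn_corr (u v : Fin d → ℝ) :
    IntegrableOn (fun t : ℝ => K.corr q u v t.toNNReal) (Set.Ioi 0) := by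
  have hu := K.integrableOn_corr_self q u
  have hv := K.integrableOn_corr_self q v
  simp only [corr_eq] at hu hv ⊢
  exact (K.isSymmetric q).integrableOn_inner_op hu hv

theorem integral_corr_self_le (u : Fin d → ℝ) :
    ∫ t in Set.Ioi (0 : ℝ), K.corr q u u t.toNNReal ≤
      4 * d / (4 * d + K.gap q) * ((q : ℝ) ^ 2 * ∑ i, u i ^ 2) := by
  simp only [corr_eq]
  exact (K.isSymmetric q).integral_Ioi_inner_op_self_le (K.hasGenerator q)
    (K.corr_bound_nonneg q u) (K.sq_inner_currentFun_le q u)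

theorem integral_corr_self_eq_sum (u : Fin d → ℝ) :
    ∫ t in Set.Ioi (0 : ℝ), K.corr q u u t.toNNReal = ∑ i, ∑ k, u i * u k *
      ∫ t in Set.Ioi (0 : ℝ), K.corr q (Pi.single i 1) (Pi.single k 1) t.toNNReal := by
  have hint (i k : Fin d) := K.integrableOn_corr q (Pi.single i 1) (Pi.single k 1)
  simp only [corr_eq, toL2_currentFun q u] at hint ⊢
  exact (K.semigroup q).integral_inner_op_sum_smul hint u

theorem dotProduct_diffusionMatrix_mulVec (u : Fin d → ℝ) :
    u ⬝ᵥ (K.diffusionMatrix q).mulVec u = (q : ℝ) ^ 2 * ∑ i, u i ^ 2 -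
      ∫ t in Set.Ioi (0 : ℝ), K.corr q u u t.toNNReal := by
  rw [integral_corr_self_eq_sum]
  simp only [dotProduct, Matrix.mulVec, diffusionMatrix, Matrix.of_apply, sub_mul,
    Finset.sum_sub_distrib, mul_sub, Finset.mul_sum, ite_mul, zero_mul, Finset.sum_ite_eq,
    Finset.mem_univ, if_true]
  congr 1
  · exact Finset.sum_congr rfl fun i _ => by ring
  · exact Finset.sum_congr rfl fun i _ => Finset.sum_congr rfl fun k _ => by ring

theorem dotProduct_diffusionMatrix_mulVec_le (u : Fin d → ℝ) :
    u ⬝ᵥ (K.diffusionMatrix q).mulVec u ≤ (q : ℝ) ^ 2 * ∑ i, u i ^ 2 := by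
  rw [dotProduct_diffusionMatrix_mulVec]
  exact sub_le_self _ (integral_nonneg fun t => K.corr_self_nonneg q u _)

theorem le_dotProduct_diffusionMatrix_mulVec (u : Fin d → ℝ) :
    K.gap q / (4 * d + K.gap q) * ((q : ℝ) ^ 2 * ∑ i, u i ^ 2) ≤
      u ⬝ᵥ (K.diffusionMatrix q).mulVec u := by
  rw [dotProduct_diffusionMatrix_mulVec]
  have hle := K.integral_corr_self_le q u
  have hsum : 4 * d / (4 * d + K.gap q) + K.gap q / (4 * d + K.gap q) ≤ 1 := by
    rw [← add_div]
    exact div_self_le_one _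
  have hmul := mul_le_mul_of_nonneg_right hsum
    (show 0 ≤ (q : ℝ) ^ 2 * ∑ i, u i ^ 2 by positivity)
  linarith

theorem posDef_diffusionMatrix (hq : 0 < q) (hgap : 0 < K.gap q) :
    (K.diffusionMatrix q).PosDef := by
  refine Matrix.PosDef.of_dotProduct_mulVec_pos ?_ fun u hu => ?_
  · ext i k
    simp only [Matrix.conjTranspose_apply, diffusionMatrix, Matrix.of_apply, star_trivial,
      eq_comm (a := k), K.corr_comm q (Pi.single k 1)]
  · obtain ⟨i, hi⟩ := Function.ne_iff.1 hu
    have hsum : 0 < ∑ i, u i ^ 2 :=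
      Finset.sum_pos' (fun i _ => sq_nonneg _) ⟨i, Finset.mem_univ i, sq_pos_of_ne_zero hi⟩
    have hq' : (0 : ℝ) < q := hq
    rw [star_trivial]
    exact lt_of_lt_of_le (by positivity) (K.le_dotProduct_diffusionMatrix_mulVec q u)

end KCSM

end Tracer

end

open Tracer in
theorem proposition2 (d : ℕ) (hd : 1 ≤ d) (q : unitInterval) (hq0 : 0 < q) (hq1 : q < 1)
    (K : KCSM d) :
    -- the semigroup `e^{tL}` exists
    (∃ S : ContractionSemigroup (L2 d q), S.HasGenerator (K.tracerGenerator q)) ∧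
    -- the diffusion matrix is well defined and is given by the usual formula
    (∀ u : Fin d → ℝ,
      IntegrableOn (fun t : ℝ => K.corr q u u t.toNNReal) (Set.Ioi 0) volume ∧
      u ⬝ᵥ (K.diffusionMatrix q).mulVec u = (q : ℝ) ^ 2 * ∑ i, u i ^ 2 -
        ∫ t in Set.Ioi (0 : ℝ), K.corr q u u t.toNNReal) ∧
    -- the bounds
    (∀ u : Fin d → ℝ,
      u ⬝ᵥ (K.diffusionMatrix q).mulVec u ≤ (q : ℝ) ^ 2 * ∑ i, u i ^ 2 ∧
      K.gap q / (4 * d + K.gap q) * ((q : ℝ) ^ 2 * ∑ i, u i ^ 2) ≤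
        u ⬝ᵥ (K.diffusionMatrix q).mulVec u) ∧
    -- positivity
    (0 < K.gap q → (K.diffusionMatrix q).PosDef) :=
  ⟨K.exists_semigroup q,
    fun u => ⟨K.integrableOn_corr_self q u, K.dotProduct_diffusionMatrix_mulVec q u⟩,
    fun u => ⟨K.dotProduct_diffusionMatrix_mulVec_le q u,
      K.le_dotProduct_diffusionMatrix_mulVec q u⟩,
    K.posDef_diffusionMatrix q hq0⟩
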